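/- **Setting.** Let $v>1$, let $\sigma_\infty=\arcsin\big(\sqrt{v^2-1}/v\big)$ and let $\sigma_1,\sigma_2\in(0,\sigma_\infty)$. In the plane with coordinates $(\xi_1,\xi_2)$ consider the domain $$\{\xi_1<0<\xi_2,\quad 1+\xi_1^2+\xi_2^2<v^2,\quad \xi_1<(\xi_2\cot\sigma_1-1)\tan\sigma_2\}.$$ Its boundary consists of the arc $\Gamma_{cone}^\infty=\{1+|\xi|^2=v^2,\ \xi_1<0<\xi_2\}$ and the open segments $\Gamma_{py}=\{\xi_1=(\xi_2\cot\sigma_1-1)\tan\sigma_2,\ \xi_1<0<\xi_2\}$, $\Gamma_{sy1}=\{\xi_1=0,\ \tan\sigma_1<\xi_2<\sqrt{v^2-1}\}$, $\Gamma_{sy2}=\{\xi_2=0,\ -\sqrt{v^2-1}<\xi_1<-\tan\sigma_2\}$, together with their end points, among them $P_3=(-\tan\sigma_2,0)$ and $P_4=(0,\tan\sigma_1)$. Through $\xi=(x_1/x_3,x_2/x_3)$ and $x/|x|=(\cos\theta,\sin\theta\cos\varphi,\sin\theta\sin\varphi)$, $0<\theta,\varphi<\pi$, all these sets are regarded as sets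 of points $\zeta=(\theta,\varphi)$, with the same names; the domain is denoted by $\Omega$. Write $D_\zeta\psi=(\partial_\theta\psi,\tfrac1{\sin\theta}\partial_\varphi\psi)$, and let $\nu_{py},\nu_{sy1},\nu_{sy2}$ be the components in the orthonormal frame $e_\theta=(-\sin\theta,\cos\theta\cos\varphi,\cos\theta\sin\varphi)$, $e_\varphi=(0,-\sin\varphi,\cos\varphi)$ of the exterior normals $(1,-\cot\sigma_1\tan\sigma_2,\tan\sigma_2)$, $(1,0,0)$, $(0,-1,0)$. For $\mu\in[0,1]$ and $\varepsilon>0$ consider the problem $$c^2\Big(\frac{\partial_\theta(\sin\theta\,\partial_\theta\psi)}{\sin\theta}+\frac{\partial_{\varphi\varphi}\psi}{\sin^2\theta}+2\psi\Big)-\mu\Big((\partial_\theta\psi)^2\partial_{\theta\theta}\psi+\frac{(\partial_\varphi\psi)^2}{\sin^2\theta}\frac{\partial_{\varphi\varphi}\psi}{\sin^2\theta}+2\,\partial_\theta\psi\,\frac{\partial_\varphi\psi}{\sin\theta}\frac{\partial_{\theta\varphi}\psi}{\sin\theta}-\cot\theta\,\frac{(\partial_\varphi\psi)^2}{\sin^2\theta}\,\partial_\theta\psi+\Big((\partial_\theta\psi)^2+\frac{(\partial_\varphi\psi)^2}{\sin^2\theta}\Big)\psi\Big)=0\quad\text{in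 }\Omega,$$ where $c^2=\psi^2+|D_\zeta\psi|^2-1$, with the boundary conditions $$\psi=1+\varepsilon\ \text{on }\Gamma_{cone}^\infty,\qquad D_\zeta\psi\cdot\nu_{py}=0\ \text{on }\Gamma_{py},\qquad D_\zeta\psi\cdot\nu_{sy1}=0\ \text{on }\Gamma_{sy1},\qquad D_\zeta\psi\cdot\nu_{sy2}=0\ \text{on }\Gamma_{sy2}.$$ **Lemma.** In (1) and (2), $\psi\in C^0(\overline\Omega)\cap C^1(\overline\Omega\setminus\overline{\Gamma_{cone}^\infty})\cap C^2\big(\overline\Omega\setminus(\overline{\Gamma_{cone}^\infty}\cup\{P_3,P_4\})\big)$ is any solution of this problem such that $\psi\ge1+\varepsilon$ in $\overline\Omega\setminus\overline{\Gamma_{cone}^\infty}$. 1. For every $\varepsilon_0>0$ there is a constant $C>0$, depending only on $v,\sigma_1,\sigma_2,\varepsilon_0$ (and so not on $\mu$, $\varepsilon$ or $\psi$), such that for all $\mu\in[0,1]$, all $\varepsilon\in(0,\varepsilon_0]$ and all such $\psi$, $$1+\varepsilon<\psi\le C\quad\text{in }\overline\Omega\setminus\overline{\Gamma_{cone}^\infty}.$$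 2. For every set $\Omega_{sub}\subset\overline\Omega$ whose closure does not meet $\overline{\Gamma_{cone}^\infty}$ there is a constant $\delta_0>0$, depending only on $v,\sigma_1,\sigma_2$ and $\Omega_{sub}$, such that for all $\mu\in[0,1]$, all $\varepsilon>0$ and all such $\psi$, $$\psi>1+\varepsilon+\delta_0\quad\text{in }\Omega_{sub}$$ (and $\psi\le C$ there, by (1), if $\varepsilon\le\varepsilon_0$). -/

import Mathlib

open scoped Matrix

namespace ChaplyginWing

noncomputable section

/-- The critical angle: half of the vertex angle of the Mach cone of the oncoming flow
`(0, 0, v)`, where the Bernoulli constant is normalised to `1`. -/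
def criticalAngle (v : ℝ) : ℝ := Real.arcsin (Real.sqrt (v ^ 2 - 1) / v)

/-! ### The domain in the conical coordinates `ξ = (x₁/x₃, x₂/x₃)` -/

/-- The curvilinear quadrilateral `P₁P₂P₃P₄`: inside the Mach cone, outside the wing, in the
quadrant `ξ₁ < 0 < ξ₂`. -/
def conicalDomain (v σ₁ σ₂ : ℝ) : Set (ℝ × ℝ) :=
  {ξ | ξ.1 < 0 ∧ 0 < ξ.2 ∧ 1 + ξ.1 ^ 2 + ξ.2 ^ 2 < v ^ 2 ∧
    ξ.1 < (ξ.2 * Real.cot σ₁ - 1) * Real.tan σ₂}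

/-- The open arc `P₁P₂` of the Mach cone. -/
def conicalCone (v : ℝ) : Set (ℝ × ℝ) :=
  {ξ | ξ.1 < 0 ∧ 0 < ξ.2 ∧ 1 + ξ.1 ^ 2 + ξ.2 ^ 2 = v ^ 2}

/-- The open segment `P₃P₄` on the wing. -/
def conicalPy (σ₁ σ₂ : ℝ) : Set (ℝ × ℝ) :=
  {ξ | ξ.1 < 0 ∧ 0 < ξ.2 ∧ ξ.1 = (ξ.2 * Real.cot σ₁ - 1) * Real.tan σ₂}

/-- The open segment `P₁P₄` of the `ξ₂`-axis. -/
def conicalSy1 (v σ₁ : ℝ) : Set (ℝ × ℝ) :=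
  {ξ | ξ.1 = 0 ∧ Real.tan σ₁ < ξ.2 ∧ ξ.2 < Real.sqrt (v ^ 2 - 1)}

/-- The open segment `P₂P₃` of the `ξ₁`-axis. -/
def conicalSy2 (v σ₂ : ℝ) : Set (ℝ × ℝ) :=
  {ξ | ξ.2 = 0 ∧ -Real.sqrt (v ^ 2 - 1) < ξ.1 ∧ ξ.1 < -Real.tan σ₂}

/-- The two corners `P₃`, `P₄` of the wing. -/
def conicalCorners (σ₁ σ₂ : ℝ) : Set (ℝ × ℝ) := {(-Real.tan σ₂, 0), (0, Real.tan σ₁)}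

/-! ### Spherical coordinates `ζ = (θ, φ)` -/

/-- The point of the unit sphere with spherical coordinates `ζ = (θ, φ)`; the polar axis is the
`x₁`-axis. -/
def spherePoint (ζ : ℝ × ℝ) : Fin 3 → ℝ :=
  ![Real.cos ζ.1, Real.sin ζ.1 * Real.cos ζ.2, Real.sin ζ.1 * Real.sin ζ.2]

/-- The unit tangent vector `e_θ`. -/
def eTheta (ζ : ℝ × ℝ) : Fin 3 → ℝ :=
  ![-Real.sin ζ.1, Real.cos ζ.1 * Real.cos ζ.2, Real.cos ζ.1 * Real.sin ζ.2]

/-- The unit tangent vector `e_φ`. -/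
def ePhi (ζ : ℝ × ℝ) : Fin 3 → ℝ := ![0, -Real.sin ζ.2, Real.cos ζ.2]

/-- The conical coordinates of the ray with spherical coordinates `ζ`. -/
def toConical (ζ : ℝ × ℝ) : ℝ × ℝ :=
  (spherePoint ζ 0 / spherePoint ζ 2, spherePoint ζ 1 / spherePoint ζ 2)

/-- A set given in conical coordinates, rewritten in spherical coordinates. The half space
`x₃ > 0` corresponds bijectively to `0 < θ < π`, `0 < φ < π`. -/
def inSpherical (A : Set (ℝ × ℝ)) : Set (ℝ × ℝ) :=
  {ζ | ζ.1 ∈ Set.Ioo 0 Real.pi ∧ ζ.2 ∈ Set.Ioo 0 Real.pi ∧ toConical ζ ∈ A}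

/-- The domain `Ω` in spherical coordinates. -/
def Om (v σ₁ σ₂ : ℝ) : Set (ℝ × ℝ) := inSpherical (conicalDomain v σ₁ σ₂)

/-- The degenerate boundary `Γ_cone` in spherical coordinates. -/
def GammaCone (v : ℝ) : Set (ℝ × ℝ) := inSpherical (conicalCone v)

/-- The wing boundary `Γ_py` in spherical coordinates. -/
def GammaPy (σ₁ σ₂ : ℝ) : Set (ℝ × ℝ) := inSpherical (conicalPy σ₁ σ₂)

/-- The symmetry boundary `Γ_sy1` (on `x₁ = 0`) in spherical coordinates. -/
def GammaSy1 (v σ₁ : ℝ) : Set (ℝ × ℝ) := inSpherical (conicalSy1 v σ₁)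

/-- The symmetry boundary `Γ_sy2` (on `x₂ = 0`) in spherical coordinates. -/
def GammaSy2 (v σ₂ : ℝ) : Set (ℝ × ℝ) := inSpherical (conicalSy2 v σ₂)

/-- The set `{P₃, P₄}` in spherical coordinates. -/
def Corners (σ₁ σ₂ : ℝ) : Set (ℝ × ℝ) := inSpherical (conicalCorners σ₁ σ₂)

/-- The set `closure Ω \ closure Γ_cone`. -/
def OmBar (v σ₁ σ₂ : ℝ) : Set (ℝ × ℝ) := closure (Om v σ₁ σ₂) \ closure (GammaCone v)

/-! ### The equation -/

/-- The partial derivative `∂_θ`. -/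
def dTheta (f : ℝ × ℝ → ℝ) (ζ : ℝ × ℝ) : ℝ := fderiv ℝ f ζ (1, 0)

/-- The partial derivative `∂_φ`. -/
def dPhi (f : ℝ × ℝ → ℝ) (ζ : ℝ × ℝ) : ℝ := fderiv ℝ f ζ (0, 1)

/-- The square of the sound speed, `c² = |∇Φ|² - 1 = ψ² + |D_ζ ψ|² - 1` for `Φ = r ψ`. -/
def soundSq (ψ : ℝ × ℝ → ℝ) (ζ : ℝ × ℝ) : ℝ :=
  ψ ζ ^ 2 + (dTheta ψ ζ ^ 2 + (dPhi ψ ζ / Real.sin ζ.1) ^ 2) - 1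

/-- The operator `N_μ`. -/
def opN (μ : ℝ) (ψ : ℝ × ℝ → ℝ) (ζ : ℝ × ℝ) : ℝ :=
  soundSq ψ ζ *
      (dTheta (fun z => Real.sin z.1 * dTheta ψ z) ζ / Real.sin ζ.1
        + dPhi (dPhi ψ) ζ / Real.sin ζ.1 ^ 2 + 2 * ψ ζ)
    - μ * (dTheta ψ ζ ^ 2 * dTheta (dTheta ψ) ζ
        + dPhi ψ ζ ^ 2 / Real.sin ζ.1 ^ 2 * (dPhi (dPhi ψ) ζ / Real.sin ζ.1 ^ 2)
        + 2 * dTheta ψ ζ * (dPhi ψ ζ / Real.sin ζ.1) * (dTheta (dPhi ψ) ζ / Real.sin ζ.1)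
        - Real.cot ζ.1 * (dPhi ψ ζ ^ 2 / Real.sin ζ.1 ^ 2) * dTheta ψ ζ
        + (dTheta ψ ζ ^ 2 + dPhi ψ ζ ^ 2 / Real.sin ζ.1 ^ 2) * ψ ζ)

/-! ### The boundary conditions -/

/-- The exterior normal in `ℝ³` of the plane `x₁ = (x₂ cot σ₁ - x₃) tan σ₂` of the wing. -/
def normalPy (σ₁ σ₂ : ℝ) : Fin 3 → ℝ := ![1, -(Real.cot σ₁ * Real.tan σ₂), Real.tan σ₂]

/-- The exterior normal in `ℝ³` of the plane `x₁ = 0`. -/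
def normalSy1 : Fin 3 → ℝ := ![1, 0, 0]

/-- The exterior normal in `ℝ³` of the plane `x₂ = 0`. -/
def normalSy2 : Fin 3 → ℝ := ![0, -1, 0]

/-- `D_ζ ψ · ν` at `ζ`, where `D_ζ = (∂_θ, (1 / sin θ) ∂_φ)` and `ν` has the components of the
spatial vector `n` in the orthonormal frame `(e_θ, e_φ)`. The derivative is taken within the
set `s`, so that it is the one-sided derivative at the boundary points of `s`. -/
def normalDeriv (s : Set (ℝ × ℝ)) (n : Fin 3 → ℝ) (ψ : ℝ × ℝ → ℝ) (ζ : ℝ × ℝ) : ℝ :=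
  fderivWithin ℝ ψ s ζ (1, 0) * (n ⬝ᵥ eTheta ζ)
    + fderivWithin ℝ ψ s ζ (0, 1) / Real.sin ζ.1 * (n ⬝ᵥ ePhi ζ)

/-- `ψ` is a solution, with the regularity
`C⁰(closure Ω) ∩ C¹(closure Ω \ closure Γ_cone) ∩ C²(closure Ω \ (closure Γ_cone ∪ {P₃, P₄}))`,
of the regularised boundary value problem with parameters `μ` and `ε`. -/
structure IsSolution (v σ₁ σ₂ μ ε : ℝ) (ψ : ℝ × ℝ → ℝ) : Prop where
  continuousOn : ContinuousOn ψ (closure (Om v σ₁ σ₂))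
  contDiffOn_one : ContDiffOn ℝ 1 ψ (OmBar v σ₁ σ₂)
  contDiffOn_two : ContDiffOn ℝ 2 ψ (OmBar v σ₁ σ₂ \ Corners σ₁ σ₂)
  equation : ∀ ζ ∈ Om v σ₁ σ₂, opN μ ψ ζ = 0
  cone : ∀ ζ ∈ GammaCone v, ψ ζ = 1 + ε
  py : ∀ ζ ∈ GammaPy σ₁ σ₂, normalDeriv (OmBar v σ₁ σ₂) (normalPy σ₁ σ₂) ψ ζ = 0
  sy1 : ∀ ζ ∈ GammaSy1 v σ₁, normalDeriv (OmBar v σ₁ σ₂) normalSy1 ψ ζ = 0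
  sy2 : ∀ ζ ∈ GammaSy2 v σ₂, normalDeriv (OmBar v σ₁ σ₂) normalSy2 ψ ζ = 0

end

end ChaplyginWing

namespace ChaplyginWing

open Real Set Filter Topology

/-! The potential `r * ψ` is homogeneous of degree one, and the second-order terms of the operator
act on `ψ` through the Hessian of this potential. Linear functions `x ↦ a ⬝ᵥ x` have zero Hessian,
so their restrictions `lin a` to the sphere serve as barriers for every `μ`. If `τ * (ψ - lin a)`
has a positive interior minimum, the gradients agree there and `τ * opN` is a sum of a nonnegative
Hessian part and a strictly positive zeroth-order part, because `1 < ψ` gives `c² > |Dψ|²`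
(`opN_ne_zero_of_isLocalMin`). Each wall lies on a plane through the origin with normal `n`, where
the normal derivative of `lin a` is the constant `n ⬝ᵥ a`; its sign rules out a minimum there
(`nonneg_of_isMinOn_wall`). Hence the minimum lies on the Mach cone, where `ψ = 1 + ε`
(`IsSolution.mem_closure_GammaCone_of_isMinOn`).

Lower bound: for `w` in `Om`, take `a = spherePoint w`. The wall inequalities `n ⬝ᵥ a < 0` are those
that define `Om`. Comparing `w` with the minimum point `z` on the cone gives `ψ w ≥ 1 + ε + (1 - w ·
z)`, and `1 - w · z` is half the squared chordal distance. Compactness makes this gap uniform away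
from the cone.

Upper bound: a fixed `a` with `n ⬝ᵥ a > 0` on all walls and `lin a` bounded below by a positive
constant, scaled to lie above `ψ`, serves as a supersolution. -/

/-! ### Linear functions on the sphere and their derivatives. -/

/-- The restriction to the sphere of the linear function `x ↦ a ⬝ᵥ x`. -/
noncomputable def lin (a : Fin 3 → ℝ) (ζ : ℝ × ℝ) : ℝ := a ⬝ᵥ spherePoint ζ

/-- The tangential projection of `a` at `ζ`, in the coordinates `(θ, φ)`. -/
noncomputable def tangentDir (a : Fin 3 → ℝ) (ζ : ℝ × ℝ) : ℝ × ℝ :=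
  (a ⬝ᵥ eTheta ζ, a ⬝ᵥ ePhi ζ / sin ζ.1)

theorem lin_eq (a : Fin 3 → ℝ) (ζ : ℝ × ℝ) :
    lin a ζ = a 0 * cos ζ.1 + a 1 * (sin ζ.1 * cos ζ.2) + a 2 * (sin ζ.1 * sin ζ.2) := by
  simp [lin, spherePoint, dotProduct, Fin.sum_univ_three]

theorem dotProduct_eTheta (a : Fin 3 → ℝ) (ζ : ℝ × ℝ) :
    a ⬝ᵥ eTheta ζ =
      -(a 0 * sin ζ.1) + a 1 * (cos ζ.1 * cos ζ.2) + a 2 * (cos ζ.1 * sin ζ.2) := by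
  simp [eTheta, dotProduct, Fin.sum_univ_three]

theorem dotProduct_ePhi (a : Fin 3 → ℝ) (ζ : ℝ × ℝ) :
    a ⬝ᵥ ePhi ζ = -(a 1 * sin ζ.2) + a 2 * cos ζ.2 := by
  simp [ePhi, dotProduct, Fin.sum_univ_three]

theorem dotProduct_three (a b : Fin 3 → ℝ) : a ⬝ᵥ b = a 0 * b 0 + a 1 * b 1 + a 2 * b 2 := by
  simp [dotProduct, Fin.sum_univ_three]

theorem contDiff_lin (a : Fin 3 → ℝ) {n : WithTop ℕ∞} : ContDiff ℝ n (lin a) := by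
  have : lin a = fun ζ => _ := funext (lin_eq a)
  rw [this]
  fun_prop

theorem continuous_lin (a : Fin 3 → ℝ) : Continuous (lin a) :=
  (contDiff_lin a (n := 0)).continuous

theorem hasFDerivAt_lin (a : Fin 3 → ℝ) (ζ : ℝ × ℝ) :
    HasFDerivAt (lin a) ((a ⬝ᵥ eTheta ζ) • ContinuousLinearMap.fst ℝ ℝ ℝ
      + (sin ζ.1 * (a ⬝ᵥ ePhi ζ)) • ContinuousLinearMap.snd ℝ ℝ ℝ) ζ := by
  have h1 : HasFDerivAt (fun z : ℝ × ℝ => z.1) (ContinuousLinearMap.fst ℝ ℝ ℝ) ζ := hasFDerivAt_fst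
  have h2 : HasFDerivAt (fun z : ℝ × ℝ => z.2) (ContinuousLinearMap.snd ℝ ℝ ℝ) ζ := hasFDerivAt_snd
  have := ((h1.cos.const_mul (a 0)).add ((h1.sin.mul h2.cos).const_mul (a 1))).add
    ((h1.sin.mul h2.sin).const_mul (a 2))
  have e : lin a = fun ζ => _ := funext (lin_eq a)
  rw [e]
  refine this.congr_fderiv ?_
  rw [dotProduct_eTheta, dotProduct_ePhi]
  ext <;> simp <;> ring

theorem dTheta_lin (a : Fin 3 → ℝ) : dTheta (lin a) = fun ζ => a ⬝ᵥ eTheta ζ := by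
  ext ζ
  simp [dTheta, (hasFDerivAt_lin a ζ).fderiv]

theorem dPhi_lin (a : Fin 3 → ℝ) : dPhi (lin a) = fun ζ => sin ζ.1 * (a ⬝ᵥ ePhi ζ) := by
  ext ζ
  simp [dPhi, (hasFDerivAt_lin a ζ).fderiv]

theorem fderiv_fderiv_apply {f : ℝ × ℝ → ℝ} {z : ℝ × ℝ} (hf : ContDiffAt ℝ 2 f z) (d e : ℝ × ℝ) :
    fderiv ℝ (fun w => fderiv ℝ f w e) z d = fderiv ℝ (fderiv ℝ f) z d e := by
  have : DifferentiableAt ℝ (fderiv ℝ f) z :=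
    (hf.fderiv_right (m := 1) (by norm_num)).differentiableAt (by norm_num)
  rw [fderiv_clm_apply this (differentiableAt_const _)]
  simp

theorem dTheta_dTheta_lin (a : Fin 3 → ℝ) (ζ : ℝ × ℝ) :
    dTheta (dTheta (lin a)) ζ = -lin a ζ := by
  have h1 : HasFDerivAt (fun z : ℝ × ℝ => z.1) (ContinuousLinearMap.fst ℝ ℝ ℝ) ζ := hasFDerivAt_fst
  have h2 : HasFDerivAt (fun z : ℝ × ℝ => z.2) (ContinuousLinearMap.snd ℝ ℝ ℝ) ζ := hasFDerivAt_snd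
  have := (((h1.sin.const_mul (a 0)).neg).add ((h1.cos.mul h2.cos).const_mul (a 1))).add
    ((h1.cos.mul h2.sin).const_mul (a 2))
  have e : dTheta (lin a) = fun ζ => _ := (dTheta_lin a).trans (funext (dotProduct_eTheta a))
  rw [e]
  have h := this.fderiv
  unfold dTheta
  refine (DFunLike.congr_fun h (1, 0)).trans ?_
  rw [lin_eq]
  simp
  ring

theorem dPhi_lin' (a : Fin 3 → ℝ) :
    dPhi (lin a) = fun ζ => sin ζ.1 * (-(a 1 * sin ζ.2) + a 2 * cos ζ.2) := by
  simp only [dPhi_lin, dotProduct_ePhi]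

theorem hasFDerivAt_dPhi_lin (a : Fin 3 → ℝ) (ζ : ℝ × ℝ) :
    HasFDerivAt (dPhi (lin a))
      ((cos ζ.1 * (-(a 1 * sin ζ.2) + a 2 * cos ζ.2)) • ContinuousLinearMap.fst ℝ ℝ ℝ
      + (-(sin ζ.1 * (a 1 * cos ζ.2 + a 2 * sin ζ.2))) • ContinuousLinearMap.snd ℝ ℝ ℝ) ζ := by
  have h1 : HasFDerivAt (fun z : ℝ × ℝ => z.1) (ContinuousLinearMap.fst ℝ ℝ ℝ) ζ := hasFDerivAt_fst
  have h2 : HasFDerivAt (fun z : ℝ × ℝ => z.2) (ContinuousLinearMap.snd ℝ ℝ ℝ) ζ := hasFDerivAt_snd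
  have := h1.sin.mul (((h2.sin.const_mul (a 1)).neg).add (h2.cos.const_mul (a 2)))
  rw [dPhi_lin']
  refine this.congr_fderiv ?_
  ext <;> simp <;> ring

theorem dPhi_dPhi_lin (a : Fin 3 → ℝ) (ζ : ℝ × ℝ) :
    dPhi (dPhi (lin a)) ζ = -(sin ζ.1 * (a 1 * cos ζ.2 + a 2 * sin ζ.2)) := by
  have := (hasFDerivAt_dPhi_lin a ζ).fderiv
  rw [dPhi, this]; simp

theorem dTheta_dPhi_lin (a : Fin 3 → ℝ) (ζ : ℝ × ℝ) :
    dTheta (dPhi (lin a)) ζ = cos ζ.1 * (-(a 1 * sin ζ.2) + a 2 * cos ζ.2) := by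
  have := (hasFDerivAt_dPhi_lin a ζ).fderiv
  rw [dTheta, this]; simp

/-! ### The comparison principle at interior points. -/

/-- The necessary second order condition at a local minimum. -/
theorem fderiv_fderiv_nonneg_of_isLocalMin {h : ℝ × ℝ → ℝ} {z : ℝ × ℝ} (hh : ContDiffAt ℝ 2 h z)
    (hz : IsLocalMin h z) (d : ℝ × ℝ) : 0 ≤ fderiv ℝ (fderiv ℝ h) z d d := by
  by_contra! hneg
  set γ : ℝ → ℝ × ℝ := fun t => z + t • d
  have hγ : ∀ t, HasDerivAt γ d t := fun t => by
    simpa [γ] using ((hasDerivAt_id t).smul_const d).const_add z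
  have hγ0 : γ 0 = z := by simp [γ]
  have hγc : Tendsto γ (𝓝 0) (𝓝 z) := by
    have := (hγ 0).continuousAt.tendsto; rwa [hγ0] at this
  have hev : ∀ᶠ w in 𝓝 z, DifferentiableAt ℝ h w := by
    filter_upwards [hh.eventually (by simp)] with w hw using hw.differentiableAt (by norm_num)
  have hg : deriv (h ∘ γ) =ᶠ[𝓝 0] fun t => fderiv ℝ h (γ t) d := by
    filter_upwards [hγc.eventually hev] with t ht
    exact (ht.hasFDerivAt.comp_hasDerivAt t (hγ t)).deriv
  have hd2 : DifferentiableAt ℝ (fderiv ℝ h) z :=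
    (hh.fderiv_right (m := 1) (by norm_num)).differentiableAt (by norm_num)
  have hg2 : deriv (deriv (h ∘ γ)) 0 = fderiv ℝ (fderiv ℝ h) z d d := by
    rw [hg.deriv_eq]
    have h1 : HasFDerivAt (fun w => fderiv ℝ h w d) (fderiv ℝ (fun w => fderiv ℝ h w d) (γ 0)) (γ 0) := by
      rw [hγ0]
      exact (hd2.clm_apply (differentiableAt_const _)).hasFDerivAt
    have := (h1.comp_hasDerivAt 0 (hγ 0)).deriv
    rw [hγ0, fderiv_fderiv_apply hh] at this
    exact this
  have hmin : IsLocalMin (h ∘ γ) 0 := by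
    filter_upwards [hγc.eventually hz] with t ht
    simpa [hγ0] using ht
  -- A negative second derivative would also make `0` a local maximum, so `h ∘ γ` would be locally
  -- constant with zero second derivative.
  have hmax : IsLocalMax (h ∘ γ) 0 := by
    refine isLocalMax_of_deriv_deriv_neg (by rw [hg2]; exact hneg) hmin.deriv_eq_zero ?_
    refine ContinuousAt.comp ?_ (hγ 0).continuousAt
    rw [hγ0]; exact hh.continuousAt
  have hconst : h ∘ γ =ᶠ[𝓝 0] fun _ => (h ∘ γ) 0 := by
    filter_upwards [hmin, hmax] with t h1 h2 using le_antisymm h2 h1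
  have h0 : deriv (deriv (h ∘ γ)) 0 = 0 := by
    have : deriv (h ∘ γ) =ᶠ[𝓝 0] fun _ => 0 := by
      simpa using hconst.deriv
    simpa using this.deriv_eq
  rw [hg2] at h0
  linarith

/-- The values of a quadratic form at `(p, q)` and at the rotated vector `(q, -p)` add up to `|(p,
q)|²` times its trace, and both are nonnegative. -/
theorem quadratic_trace_bound {p q α β γ μ : ℝ} (hμ : μ ∈ Icc (0 : ℝ) 1)
    (hpsd : ∀ x y : ℝ, 0 ≤ x ^ 2 * α + 2 * (x * y) * β + y ^ 2 * γ) :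
    μ * (p ^ 2 * α + 2 * (p * q) * β + q ^ 2 * γ) ≤ (p ^ 2 + q ^ 2) * (α + γ) := by
  have h1 := hpsd p q
  have h2 := hpsd q (-p)
  nlinarith [mul_nonneg (sub_nonneg.2 hμ.2) h1]

/-- Comparison with linear functions: the operator does not vanish at an interior point where
`τ (ψ - l)` is minimal and positive. -/
theorem opN_ne_zero_of_isLocalMin {μ τ : ℝ} {ψ : ℝ × ℝ → ℝ} {a : Fin 3 → ℝ} {z : ℝ × ℝ}
    (hμ : μ ∈ Icc (0 : ℝ) 1) (hs : 0 < sin z.1) (hψ : ContDiffAt ℝ 2 ψ z)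
    (hmin : IsLocalMin (fun w => τ * (ψ w - lin a w)) z) (hτ : τ ≠ 0) (h1 : 1 < ψ z)
    (hpos : 0 < τ * (ψ z - lin a z)) : opN μ ψ z ≠ 0 := by
  have hl : ContDiffAt ℝ 2 (lin a) z := (contDiff_lin a).contDiffAt
  have hh : ContDiffAt ℝ 2 (fun w => τ * (ψ w - lin a w)) z := contDiffAt_const.mul (hψ.sub hl)
  have hfd : fderiv ℝ (fun w => τ * (ψ w - lin a w)) =ᶠ[𝓝 z]
      fun w => τ • (fderiv ℝ ψ w - fderiv ℝ (lin a) w) := by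
    filter_upwards [hψ.eventually (by simp)] with w hw
    have e1 := hw.differentiableAt (by norm_num : (2 : WithTop ℕ∞) ≠ 0)
    have e2 : DifferentiableAt ℝ (lin a) w := (hasFDerivAt_lin a w).differentiableAt
    exact ((e1.hasFDerivAt.sub e2.hasFDerivAt).const_mul τ).fderiv
  have d1 : DifferentiableAt ℝ (fderiv ℝ ψ) z :=
    (hψ.fderiv_right (m := 1) (by norm_num)).differentiableAt (by norm_num)
  have d2 : DifferentiableAt ℝ (fderiv ℝ (lin a)) z :=
    (hl.fderiv_right (m := 1) (by norm_num)).differentiableAt (by norm_num)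
  have hgrad : fderiv ℝ ψ z = fderiv ℝ (lin a) z := by
    have := hmin.fderiv_eq_zero
    rw [hfd.eq_of_nhds, smul_eq_zero] at this
    exact sub_eq_zero.1 (this.resolve_left hτ)
  have hfd2 : fderiv ℝ (fderiv ℝ (fun w => τ * (ψ w - lin a w))) z
      = τ • (fderiv ℝ (fderiv ℝ ψ) z - fderiv ℝ (fderiv ℝ (lin a)) z) := by
    rw [hfd.fderiv_eq]
    exact ((d1.hasFDerivAt.sub d2.hasFDerivAt).const_smul τ).fderiv
  have gθ : dTheta ψ z = a ⬝ᵥ eTheta z := by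
    rw [← congrFun (dTheta_lin a) z, dTheta, dTheta, hgrad]
  have gφ : dPhi ψ z = sin z.1 * (a ⬝ᵥ ePhi z) := by
    rw [← congrFun (dPhi_lin a) z, dPhi, dPhi, hgrad]
  -- These are the second derivatives of `ψ - lin a`. Its gradient vanishes at `z`, so they already
  -- form the covariant Hessian there.
  set α := dTheta (dTheta ψ) z + lin a z with hα
  set β := dTheta (dPhi ψ) z - cos z.1 * (-(a 1 * sin z.2) + a 2 * cos z.2) with hβ
  set γ := dPhi (dPhi ψ) z + sin z.1 * (a 1 * cos z.2 + a 2 * sin z.2) with hγ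
  have hquad : ∀ x y : ℝ, 0 ≤ x ^ 2 * (τ * α) + 2 * (x * y) * (τ * β / sin z.1)
      + y ^ 2 * (τ * γ / sin z.1 ^ 2) := by
    intro x y
    have key := fderiv_fderiv_nonneg_of_isLocalMin hh hmin (x, y / sin z.1)
    rw [hfd2] at key
    have hd : ((x, y / sin z.1) : ℝ × ℝ) = x • (1, 0) + (y / sin z.1) • (0, 1) := by simp
    have s1 := hψ.isSymmSndFDerivAt (by simp) (0, 1) (1, 0)
    have s2 := hl.isSymmSndFDerivAt (by simp) (0, 1) (1, 0)
    have e1 : fderiv ℝ (fderiv ℝ ψ) z (1, 0) (1, 0) = dTheta (dTheta ψ) z :=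
      (fderiv_fderiv_apply hψ _ _).symm
    have e2 : fderiv ℝ (fderiv ℝ ψ) z (1, 0) (0, 1) = dTheta (dPhi ψ) z :=
      (fderiv_fderiv_apply hψ _ _).symm
    have e3 : fderiv ℝ (fderiv ℝ ψ) z (0, 1) (0, 1) = dPhi (dPhi ψ) z :=
      (fderiv_fderiv_apply hψ _ _).symm
    have l1 : fderiv ℝ (fderiv ℝ (lin a)) z (1, 0) (1, 0) = _ :=
      (fderiv_fderiv_apply hl _ _).symm.trans (dTheta_dTheta_lin a z)
    have l2 : fderiv ℝ (fderiv ℝ (lin a)) z (1, 0) (0, 1) = _ :=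
      (fderiv_fderiv_apply hl _ _).symm.trans (dTheta_dPhi_lin a z)
    have l3 : fderiv ℝ (fderiv ℝ (lin a)) z (0, 1) (0, 1) = _ :=
      (fderiv_fderiv_apply hl _ _).symm.trans (dPhi_dPhi_lin a z)
    rw [hd] at key
    simp only [map_add, map_smul, add_apply, smul_apply, sub_apply, smul_eq_mul, s1, s2, e1, e2, e3,
      l1, l2, l3] at key
    refine key.trans_eq ?_
    simp only [hα, hβ, hγ]
    field_simp
    ring
  have hsd : dTheta (fun w => sin w.1 * dTheta ψ w) z
      = cos z.1 * dTheta ψ z + sin z.1 * dTheta (dTheta ψ) z := by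
    have f1 : HasFDerivAt (fun w : ℝ × ℝ => w.1) (ContinuousLinearMap.fst ℝ ℝ ℝ) z := hasFDerivAt_fst
    have f2 : HasFDerivAt (dTheta ψ) (fderiv ℝ (dTheta ψ) z) z :=
      (d1.clm_apply (differentiableAt_const _)).hasFDerivAt
    have := (f1.sin.mul f2).fderiv
    unfold dTheta at this ⊢
    refine (DFunLike.congr_fun this (1, 0)).trans ?_
    simp
    ring
  set p := a ⬝ᵥ eTheta z with hp
  set q := a ⬝ᵥ ePhi z with hq
  have hne : sin z.1 ≠ 0 := hs.ne'
  -- The terms of `lin a` cancel: only the Hessian and the value of `ψ - lin a` remain, with `c²`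
  -- taken from `ψ`.
  have hid : τ * opN μ ψ z =
      (ψ z ^ 2 + (p ^ 2 + q ^ 2) - 1) * (τ * α + τ * γ / sin z.1 ^ 2)
      - μ * (p ^ 2 * (τ * α) + 2 * (p * q) * (τ * β / sin z.1) + q ^ 2 * (τ * γ / sin z.1 ^ 2))
      + τ * (ψ z - lin a z) * (2 * (ψ z ^ 2 + (p ^ 2 + q ^ 2) - 1) - μ * (p ^ 2 + q ^ 2)) := by
    have r1 : dTheta (dTheta ψ) z = α - lin a z := by simp [hα]
    have r2 : dTheta (dPhi ψ) z = β + cos z.1 * q := by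
      rw [hβ, hq, dotProduct_ePhi]; ring
    have r3 : dPhi (dPhi ψ) z = γ - sin z.1 * (sin z.1 * lin a z + cos z.1 * p) := by
      rw [hγ, hp, lin_eq, dotProduct_eTheta]
      linear_combination (sin z.1 * (a 1 * cos z.2 + a 2 * sin z.2)) * sin_sq_add_cos_sq z.1
    unfold opN soundSq
    rw [hsd, gθ, gφ, r1, r2, r3, Real.cot_eq_cos_div_sin]
    field_simp
    ring
  intro h0
  rw [h0, mul_zero] at hid
  have hb := quadratic_trace_bound (p := p) (q := q) hμ hquad
  have t1 := hquad 1 0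
  have t2 := hquad 0 1
  -- Split `c²` into `ψ² - 1 > 0` and `p² + q²`. The latter times the trace absorbs the `μ` part of
  -- the Hessian, and the zeroth-order coefficient stays positive since `μ ≤ 1`.
  have hψ1 : 0 < ψ z ^ 2 - 1 := by nlinarith
  have u1 : 0 ≤ (ψ z ^ 2 - 1) * (τ * α + τ * γ / sin z.1 ^ 2) := by
    apply mul_nonneg hψ1.le; linarith
  have u2 : 0 < 2 * (ψ z ^ 2 + (p ^ 2 + q ^ 2) - 1) - μ * (p ^ 2 + q ^ 2) := by
    nlinarith [mul_nonneg (sub_nonneg.2 hμ.2) (add_nonneg (sq_nonneg p) (sq_nonneg q)),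
      sq_nonneg p, sq_nonneg q]
  have u3 := mul_pos hpos u2
  linarith

/-! ### The domain and its boundary as linear inequalities on the sphere. -/

/-- The points of the coordinate chart, corresponding to the half space `x₃ > 0`. -/
def chart : Set (ℝ × ℝ) := {ζ | ζ.1 ∈ Ioo 0 π ∧ ζ.2 ∈ Ioo 0 π}

/-- The outward normal to the Mach cone, scaled such that the region inside the cone is
`lin (normalCone v) < -1`. -/
def normalCone (v : ℝ) : Fin 3 → ℝ := ![0, 0, -v]

theorem isOpen_chart : IsOpen chart := isOpen_Ioo.prod isOpen_Ioo

theorem lin_normalSy1 (ζ : ℝ × ℝ) : lin normalSy1 ζ = spherePoint ζ 0 := by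
  rw [lin, dotProduct_three]; simp [normalSy1]

theorem lin_normalSy2 (ζ : ℝ × ℝ) : lin normalSy2 ζ = -spherePoint ζ 1 := by
  rw [lin, dotProduct_three]; simp [normalSy2]

theorem lin_normalCone (v : ℝ) (ζ : ℝ × ℝ) : lin (normalCone v) ζ = -(v * spherePoint ζ 2) := by
  rw [lin, dotProduct_three]; simp [normalCone]

theorem lin_normalPy (σ₁ σ₂ : ℝ) (ζ : ℝ × ℝ) : lin (normalPy σ₁ σ₂) ζ =
    spherePoint ζ 0 - (spherePoint ζ 1 * cot σ₁ - spherePoint ζ 2) * tan σ₂ := by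
  rw [lin, dotProduct_three]; simp [normalPy]; ring

theorem spherePoint_sq (ζ : ℝ × ℝ) :
    spherePoint ζ 0 ^ 2 + spherePoint ζ 1 ^ 2 + spherePoint ζ 2 ^ 2 = 1 := by
  simp [spherePoint]
  linear_combination sin ζ.1 ^ 2 * sin_sq_add_cos_sq ζ.2 + sin_sq_add_cos_sq ζ.1

theorem spherePoint_two_pos {ζ : ℝ × ℝ} (h : ζ ∈ chart) : 0 < spherePoint ζ 2 := by
  have := mul_pos (sin_pos_of_mem_Ioo h.1) (sin_pos_of_mem_Ioo h.2)
  simpa [spherePoint] using this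

/-- Multiplication by `x₃ > 0` makes the plane conditions linear; on the unit sphere `1 + |ξ|² = 1 /
x₃²`, so the cone condition becomes `v * x₃ > 1`. -/
theorem mem_Om_iff {v σ₁ σ₂ : ℝ} (hv : 1 < v) {ζ : ℝ × ℝ} : ζ ∈ Om v σ₁ σ₂ ↔
    ζ ∈ chart ∧ lin normalSy1 ζ < 0 ∧ lin normalSy2 ζ < 0 ∧ lin (normalPy σ₁ σ₂) ζ < 0 ∧
      lin (normalCone v) ζ < -1 := by
  by_cases h : ζ ∈ chart
  swap
  · refine ⟨fun h' => (h ⟨h'.1, h'.2.1⟩).elim, fun h' => (h h'.1).elim⟩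
  have hx := spherePoint_two_pos h
  have hs := spherePoint_sq ζ
  have e1 : spherePoint ζ 0 / spherePoint ζ 2 < 0 ↔ spherePoint ζ 0 < 0 := by
    rw [div_lt_iff₀ hx, zero_mul]
  have e2 : 0 < spherePoint ζ 1 / spherePoint ζ 2 ↔ 0 < spherePoint ζ 1 := by
    rw [lt_div_iff₀ hx, zero_mul]
  have e3 : spherePoint ζ 0 / spherePoint ζ 2
      < (spherePoint ζ 1 / spherePoint ζ 2 * cot σ₁ - 1) * tan σ₂ ↔
      spherePoint ζ 0 < (spherePoint ζ 1 * cot σ₁ - spherePoint ζ 2) * tan σ₂ := by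
    rw [div_lt_iff₀ hx]
    have : (spherePoint ζ 1 / spherePoint ζ 2 * cot σ₁ - 1) * tan σ₂ * spherePoint ζ 2
      = (spherePoint ζ 1 * cot σ₁ - spherePoint ζ 2) * tan σ₂ := by field_simp
    rw [this]
  have e4 : 1 + (spherePoint ζ 0 / spherePoint ζ 2) ^ 2 + (spherePoint ζ 1 / spherePoint ζ 2) ^ 2
      < v ^ 2 ↔ 1 < v * spherePoint ζ 2 := by
    have : 1 + (spherePoint ζ 0 / spherePoint ζ 2) ^ 2 + (spherePoint ζ 1 / spherePoint ζ 2) ^ 2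
      = 1 / spherePoint ζ 2 ^ 2 := by field_simp; linarith
    rw [this, div_lt_iff₀ (by positivity), ← mul_pow, one_lt_sq_iff₀ (by positivity)]
  simp only [Om, inSpherical, conicalDomain, toConical, mem_ofPred_eq, e1, e2, e3, e4,
    lin_normalSy1, lin_normalSy2, lin_normalPy, lin_normalCone]
  refine ⟨fun ⟨h1, h2, h3, h4, h5, h6⟩ => ⟨h, h3, by linarith, by linarith, by linarith⟩,
    fun ⟨_, h3, h4, h5, h6⟩ => ⟨h.1, h.2, h3, by linarith, by linarith, by linarith⟩⟩

theorem mem_GammaCone_iff {v : ℝ} (hv : 1 < v) {ζ : ℝ × ℝ} : ζ ∈ GammaCone v ↔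
    ζ ∈ chart ∧ lin normalSy1 ζ < 0 ∧ lin normalSy2 ζ < 0 ∧ lin (normalCone v) ζ = -1 := by
  by_cases h : ζ ∈ chart
  swap
  · refine ⟨fun h' => (h ⟨h'.1, h'.2.1⟩).elim, fun h' => (h h'.1).elim⟩
  have hx := spherePoint_two_pos h
  have hs := spherePoint_sq ζ
  have e1 : spherePoint ζ 0 / spherePoint ζ 2 < 0 ↔ spherePoint ζ 0 < 0 := by
    rw [div_lt_iff₀ hx, zero_mul]
  have e2 : 0 < spherePoint ζ 1 / spherePoint ζ 2 ↔ 0 < spherePoint ζ 1 := by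
    rw [lt_div_iff₀ hx, zero_mul]
  have e4 : 1 + (spherePoint ζ 0 / spherePoint ζ 2) ^ 2 + (spherePoint ζ 1 / spherePoint ζ 2) ^ 2
      = v ^ 2 ↔ v * spherePoint ζ 2 = 1 := by
    have : 1 + (spherePoint ζ 0 / spherePoint ζ 2) ^ 2 + (spherePoint ζ 1 / spherePoint ζ 2) ^ 2
      = 1 / spherePoint ζ 2 ^ 2 := by field_simp; linarith
    rw [this, div_eq_iff (by positivity), ← mul_pow, eq_comm, pow_eq_one_iff_of_nonneg
      (by positivity) (by norm_num)]
  simp only [GammaCone, inSpherical, conicalCone, toConical, mem_ofPred_eq, e1, e2, e4,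
    lin_normalSy1, lin_normalSy2, lin_normalCone, neg_inj, neg_lt_zero]
  exact ⟨fun ⟨_, _, h'⟩ => ⟨h, h'⟩, fun ⟨_, h'⟩ => ⟨h.1, h.2, h'⟩⟩

theorem mem_GammaPy_of_lin {σ₁ σ₂ : ℝ} {ζ : ℝ × ℝ} (h : ζ ∈ chart)
    (h1 : lin normalSy1 ζ < 0) (h2 : lin normalSy2 ζ < 0) (h3 : lin (normalPy σ₁ σ₂) ζ = 0) :
    ζ ∈ GammaPy σ₁ σ₂ := by
  have hx := spherePoint_two_pos h
  rw [lin_normalSy1] at h1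
  rw [lin_normalSy2] at h2
  rw [lin_normalPy] at h3
  refine ⟨h.1, h.2, div_neg_of_neg_of_pos h1 hx, div_pos (by linarith) hx, ?_⟩
  simp only [toConical]
  rw [div_eq_iff hx.ne']
  have : (spherePoint ζ 1 / spherePoint ζ 2 * cot σ₁ - 1) * tan σ₂ * spherePoint ζ 2
      = (spherePoint ζ 1 * cot σ₁ - spherePoint ζ 2) * tan σ₂ := by field_simp
  linarith

theorem isOpen_Om {v σ₁ σ₂ : ℝ} (hv : 1 < v) : IsOpen (Om v σ₁ σ₂) := by
  have : Om v σ₁ σ₂ = chart ∩ ({ζ | lin normalSy1 ζ < 0} ∩ ({ζ | lin normalSy2 ζ < 0} ∩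
      ({ζ | lin (normalPy σ₁ σ₂) ζ < 0} ∩ {ζ | lin (normalCone v) ζ < -1}))) := by
    ext ζ; exact mem_Om_iff hv
  rw [this]
  have ho : ∀ a c, IsOpen {ζ | lin a ζ < c} := fun a c =>
    isOpen_lt (continuous_lin a) continuous_const
  exact isOpen_chart.inter ((ho _ _).inter ((ho _ _).inter ((ho _ _).inter (ho _ _))))

/-! ### Tangential directions that enter the domain. -/

/-- This is the inner product of the tangential projections `a - (a · x) x` and `n - (n · x) x`. On
the plane `n · x = 0` the correction drops out, leaving the constant `a ⬝ᵥ n`. -/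
theorem tangentDir_lin (n a : Fin 3 → ℝ) {z : ℝ × ℝ} (hs : sin z.1 ≠ 0) :
    (a ⬝ᵥ eTheta z) * (n ⬝ᵥ eTheta z) + sin z.1 * (a ⬝ᵥ ePhi z) * (n ⬝ᵥ ePhi z / sin z.1)
      = a ⬝ᵥ n - lin a z * lin n z := by
  have : sin z.1 * (a ⬝ᵥ ePhi z) * (n ⬝ᵥ ePhi z / sin z.1) = (a ⬝ᵥ ePhi z) * (n ⬝ᵥ ePhi z) := by
    field_simp
  rw [this, lin_eq, lin_eq, dotProduct_eTheta, dotProduct_ePhi, dotProduct_eTheta, dotProduct_ePhi,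
    dotProduct_three]
  have h1 := sin_sq_add_cos_sq z.1
  have h2 := sin_sq_add_cos_sq z.2
  have c1 : cos z.1 ^ 2 = 1 - sin z.1 ^ 2 := by linarith
  have c2 : cos z.2 ^ 2 = 1 - sin z.2 ^ 2 := by linarith
  ring_nf
  rw [c1, c2]
  ring

theorem hasDerivAt_lin_tangentDir (a n : Fin 3 → ℝ) {z : ℝ × ℝ} (hs : sin z.1 ≠ 0) :
    HasDerivAt (fun t : ℝ => lin a (z + t • tangentDir n z)) (a ⬝ᵥ n - lin a z * lin n z) 0 := by
  have hγ : HasDerivAt (fun t : ℝ => z + t • tangentDir n z) (tangentDir n z) 0 := by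
    simpa using ((hasDerivAt_id (0 : ℝ)).smul_const (tangentDir n z)).const_add z
  have hl := hasFDerivAt_lin a z
  have e : z + (0 : ℝ) • tangentDir n z = z := by simp
  rw [← e] at hl
  have := hl.comp_hasDerivAt 0 hγ
  rw [e] at this
  refine this.congr_deriv ?_
  rw [← tangentDir_lin n a hs]
  simp [tangentDir]

theorem eventually_lin_lt {a n : Fin 3 → ℝ} {c : ℝ} {z : ℝ × ℝ} (hs : sin z.1 ≠ 0)
    (h : lin a z < c ∨ lin a z = c ∧ a ⬝ᵥ n - lin a z * lin n z < 0) :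
    ∀ᶠ t : ℝ in 𝓝[>] 0, lin a (z + t • tangentDir n z) < c := by
  have hd := hasDerivAt_lin_tangentDir a n hs
  have e : z + (0 : ℝ) • tangentDir n z = z := by simp
  rcases h with h | ⟨h, h'⟩
  · have := hd.continuousAt.tendsto
    simp only [e] at this
    exact (this.mono_left nhdsWithin_le_nhds).eventually_lt_const h
  · have := hd.hasDerivWithinAt.limsup_slope_le' (s := Ioi 0) (by simp) h'
    filter_upwards [this, self_mem_nhdsWithin] with t ht htp
    rw [slope_def_field, sub_zero, e, h, div_lt_iff₀ htp] at ht
    linarith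

/-- The direction of the tangential projection of `a` enters the domain at `z` if `a` points inside
across every part of the boundary that contains `z`. -/
theorem eventually_mem_Om {v σ₁ σ₂ : ℝ} (hv : 1 < v) {a : Fin 3 → ℝ} {z : ℝ × ℝ} (hz : z ∈ chart)
    (h1 : lin normalSy1 z < 0 ∨ lin normalSy1 z = 0 ∧ normalSy1 ⬝ᵥ a < 0)
    (h2 : lin normalSy2 z < 0 ∨ lin normalSy2 z = 0 ∧ normalSy2 ⬝ᵥ a < 0)
    (h3 : lin (normalPy σ₁ σ₂) z < 0 ∨ lin (normalPy σ₁ σ₂) z = 0 ∧ normalPy σ₁ σ₂ ⬝ᵥ a < 0)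
    (h4 : lin (normalCone v) z < -1 ∨ lin (normalCone v) z = -1 ∧
      normalCone v ⬝ᵥ a - lin (normalCone v) z * lin a z < 0) :
    ∀ᶠ t : ℝ in 𝓝[>] 0, z + t • tangentDir a z ∈ Om v σ₁ σ₂ := by
  have hs : sin z.1 ≠ 0 := (sin_pos_of_mem_Ioo hz.1).ne'
  have key : ∀ n : Fin 3 → ℝ, (lin n z < 0 ∨ lin n z = 0 ∧ n ⬝ᵥ a < 0) →
      ∀ᶠ t : ℝ in 𝓝[>] 0, lin n (z + t • tangentDir a z) < 0 := fun n hn =>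
    eventually_lin_lt hs (hn.imp_right fun h => ⟨h.1, by rw [h.1]; simpa using h.2⟩)
  have hc : ∀ᶠ t : ℝ in 𝓝[>] 0, z + t • tangentDir a z ∈ chart := by
    have : Tendsto (fun t : ℝ => z + t • tangentDir a z) (𝓝 0) (𝓝 z) := by
      have : ContinuousAt (fun t : ℝ => z + t • tangentDir a z) 0 := by fun_prop
      simpa [ContinuousAt] using this
    exact (this.mono_left nhdsWithin_le_nhds).eventually (isOpen_chart.mem_nhds hz)
  filter_upwards [hc, key _ h1, key _ h2, key _ h3, eventually_lin_lt hs h4] with t t0 t1 t2 t3 t4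
  exact (mem_Om_iff hv).2 ⟨t0, t1, t2, t3, t4⟩

theorem mem_closure_of_eventually {s : Set (ℝ × ℝ)} {z d : ℝ × ℝ}
    (h : ∀ᶠ t : ℝ in 𝓝[>] 0, z + t • d ∈ s) : z ∈ closure s := by
  refine mem_closure_of_tendsto (b := 𝓝[>] (0 : ℝ)) (f := fun t : ℝ => z + t • d) ?_ h
  have : ContinuousAt (fun t : ℝ => z + t • d) 0 := by fun_prop
  have h' := this.tendsto
  simp only [zero_smul, add_zero] at h'
  exact h'.mono_left nhdsWithin_le_nhds

/-! ### The closures of the domain and of the Mach arc. -/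

theorem closure_Om_subset {v σ₁ σ₂ : ℝ} (hv : 1 < v) {z : ℝ × ℝ} (hz : z ∈ closure (Om v σ₁ σ₂)) :
    z ∈ chart ∧ lin normalSy1 z ≤ 0 ∧ lin normalSy2 z ≤ 0 ∧ lin (normalPy σ₁ σ₂) z ≤ 0 ∧
      lin (normalCone v) z ≤ -1 := by
  have key : ∀ (a : Fin 3 → ℝ) (c : ℝ), (∀ ζ ∈ Om v σ₁ σ₂, lin a ζ < c) → lin a z ≤ c := by
    intro a c h
    exact closure_minimal (fun ζ hζ => (h ζ hζ).le)
      (isClosed_le (continuous_lin a) continuous_const) hz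
  have k1 := key normalSy1 0 fun ζ h => ((mem_Om_iff hv).1 h).2.1
  have k2 := key normalSy2 0 fun ζ h => ((mem_Om_iff hv).1 h).2.2.1
  have k3 := key _ 0 fun ζ h => ((mem_Om_iff hv).1 h).2.2.2.1
  have k4 := key _ (-1) fun ζ h => ((mem_Om_iff hv).1 h).2.2.2.2
  refine ⟨?_, k1, k2, k3, k4⟩
  have hb : z ∈ Icc 0 π ×ˢ Icc 0 π := by
    refine closure_minimal (fun ζ hζ => ?_) (isClosed_Icc.prod isClosed_Icc) hz
    have := ((mem_Om_iff hv).1 hζ).1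
    exact ⟨Ioo_subset_Icc_self this.1, Ioo_subset_Icc_self this.2⟩
  -- The cone inequality forces `x₃ ≥ 1 / v`, which keeps the closure away from the edges of the
  -- chart.
  have hp : 0 < sin z.1 * sin z.2 := by
    rw [lin_normalCone] at k4
    have : 0 < v * spherePoint z 2 := by linarith
    have := (pos_iff_pos_of_mul_pos this).1 (by linarith)
    simpa [spherePoint] using this
  have s1 : sin z.1 ≠ 0 := fun h => by simp [h] at hp
  have s2 : sin z.2 ≠ 0 := fun h => by simp [h] at hp
  refine ⟨⟨lt_of_le_of_ne hb.1.1 ?_, lt_of_le_of_ne hb.1.2 ?_⟩,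
    ⟨lt_of_le_of_ne hb.2.1 ?_, lt_of_le_of_ne hb.2.2 ?_⟩⟩ <;> intro h
  · rw [← h] at s1; simp at s1
  · rw [h] at s1; simp at s1
  · rw [← h] at s2; simp at s2
  · rw [h] at s2; simp at s2

theorem isCompact_closure_Om {v σ₁ σ₂ : ℝ} (hv : 1 < v) : IsCompact (closure (Om v σ₁ σ₂)) := by
  refine (isCompact_Icc.prod isCompact_Icc : IsCompact (Icc 0 π ×ˢ Icc 0 π)).of_isClosed_subset
    isClosed_closure ?_
  intro z hz
  have := (closure_Om_subset hv hz).1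
  exact ⟨Ioo_subset_Icc_self this.1, Ioo_subset_Icc_self this.2⟩

/-- `σ` is an angle between `0` and the critical angle. -/
theorem angle_bounds {v σ : ℝ} (hv : 1 < v) (hσ : σ ∈ Ioo 0 (criticalAngle v)) :
    0 < tan σ ∧ tan σ ^ 2 < v ^ 2 - 1 ∧ cot σ * tan σ = 1 := by
  have hq : criticalAngle v ≤ π / 2 := arcsin_le_pi_div_two _
  have h2 : σ < π / 2 := hσ.2.trans_le hq
  have hc : 0 < cos σ := cos_pos_of_mem_Ioo ⟨by linarith [hσ.1, pi_pos], h2⟩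
  have hs : 0 < sin σ := sin_pos_of_pos_of_lt_pi hσ.1 (by linarith [pi_pos])
  have hlt : sin σ < √(v ^ 2 - 1) / v :=
    (lt_arcsin_iff_sin_lt' ⟨by linarith [hσ.1, pi_pos], h2⟩).1 hσ.2
  have hv0 : 0 < v := by linarith
  have hsq : sin σ ^ 2 * v ^ 2 < v ^ 2 - 1 := by
    rw [lt_div_iff₀ hv0] at hlt
    have := pow_lt_pow_left₀ hlt (by positivity) (two_ne_zero)
    rwa [sq_sqrt (by nlinarith), mul_pow] at this
  refine ⟨tan_pos_of_pos_of_lt_pi_div_two hσ.1 h2, ?_, ?_⟩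
  · rw [tan_eq_sin_div_cos, div_pow, div_lt_iff₀ (by positivity)]
    have := sin_sq_add_cos_sq σ
    nlinarith
  · rw [tan_eq_sin_div_cos, cot_eq_cos_div_sin]; field_simp

/-- The wing lies inside the Mach cone. -/
theorem lin_normalCone_lt {v σ₁ σ₂ : ℝ} (hv : 1 < v) (hσ₁ : σ₁ ∈ Ioo 0 (criticalAngle v))
    (hσ₂ : σ₂ ∈ Ioo 0 (criticalAngle v)) {z : ℝ × ℝ} (hz : z ∈ chart)
    (h1 : lin normalSy1 z ≤ 0) (h2 : lin normalSy2 z ≤ 0) (h3 : 0 ≤ lin (normalPy σ₁ σ₂) z) :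
    lin (normalCone v) z < -1 := by
  obtain ⟨p1, q1, r1⟩ := angle_bounds hv hσ₁
  obtain ⟨p2, q2, r2⟩ := angle_bounds hv hσ₂
  have hx := spherePoint_two_pos hz
  have hs := spherePoint_sq z
  rw [lin_normalSy1] at h1
  rw [lin_normalSy2] at h2
  rw [lin_normalPy] at h3
  rw [lin_normalCone]
  set x := spherePoint z 0
  set y := spherePoint z 1
  set w := spherePoint z 2
  have hcot : 0 < cot σ₁ := pos_of_mul_pos_left (by rw [r1]; norm_num) p1.le
  -- With `u` between `0` and `w`, one has `y = u * tan σ₁` and `|x| ≤ (w - u) * tan σ₂`. Since `(w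
  -- - u)² + u² ≤ w²`, the larger of the two tangents bounds `x² + y²`, and both squares are below
  -- `v² - 1`.
  set u := y * cot σ₁ with hu
  have hy : y = u * tan σ₁ := by rw [hu, mul_assoc, r1, mul_one]
  have hu0 : 0 ≤ u := mul_nonneg (by linarith) hcot.le
  have hxl : -x ≤ (w - u) * tan σ₂ := by linarith
  have huw : u ≤ w := by
    by_contra! h
    nlinarith [mul_pos (sub_pos.2 h) p2]
  have hxs : x ^ 2 ≤ (w - u) ^ 2 * tan σ₂ ^ 2 := by
    rw [← mul_pow, ← neg_sq x]
    exact pow_le_pow_left₀ (by linarith) hxl 2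
  have hb : (w - u) ^ 2 + u ^ 2 ≤ w ^ 2 := by nlinarith
  have hb0 : 0 < (w - u) ^ 2 + u ^ 2 := by
    rcases hu0.eq_or_lt with h | h
    · rw [← h]; simpa using (by positivity : 0 < w ^ 2)
    · positivity
  have hlt : (w - u) ^ 2 * tan σ₂ ^ 2 + u ^ 2 * tan σ₁ ^ 2 < (v ^ 2 - 1) * w ^ 2 := by
    set m := max (tan σ₁ ^ 2) (tan σ₂ ^ 2) with hm
    have hm1 : m < v ^ 2 - 1 := max_lt q1 q2
    have hm2 : (w - u) ^ 2 * tan σ₂ ^ 2 ≤ (w - u) ^ 2 * m :=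
      mul_le_mul_of_nonneg_left (le_max_right _ _) (sq_nonneg _)
    have hm3 : u ^ 2 * tan σ₁ ^ 2 ≤ u ^ 2 * m :=
      mul_le_mul_of_nonneg_left (le_max_left _ _) (sq_nonneg _)
    have hm4 : 0 ≤ m := (sq_nonneg _).trans (le_max_left _ _)
    have := mul_lt_mul_of_pos_right hm1 (by positivity : 0 < w ^ 2)
    nlinarith [mul_le_mul_of_nonneg_left hb hm4]
  have : 1 < (v * w) ^ 2 := by
    rw [hy] at hs
    nlinarith
  have := (one_lt_sq_iff₀ (by positivity)).1 this
  linarith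

theorem mem_closure_Om {v σ₁ σ₂ : ℝ} (hv : 1 < v) (hσ₁ : σ₁ ∈ Ioo 0 (criticalAngle v))
    (hσ₂ : σ₂ ∈ Ioo 0 (criticalAngle v)) {z : ℝ × ℝ} (hz : z ∈ chart)
    (h1 : lin normalSy1 z ≤ 0) (h2 : lin normalSy2 z ≤ 0) (h3 : lin (normalPy σ₁ σ₂) z ≤ 0)
    (h4 : lin (normalCone v) z < -1) : z ∈ closure (Om v σ₁ σ₂) := by
  obtain ⟨p1, q1, r1⟩ := angle_bounds hv hσ₁
  obtain ⟨p2, q2, r2⟩ := angle_bounds hv hσ₂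
  have hcot : 0 < cot σ₁ := pos_of_mul_pos_left (by rw [r1]; norm_num) p1.le
  -- The vector `(-1, 1, 0)` points strictly inside all three wall planes, so it serves every face
  -- and corner at once.
  refine mem_closure_of_eventually (eventually_mem_Om hv (a := ![-1, 1, 0]) hz
    (h1.lt_or_eq.imp_right fun h => ⟨h, ?_⟩) (h2.lt_or_eq.imp_right fun h => ⟨h, ?_⟩)
    (h3.lt_or_eq.imp_right fun h => ⟨h, ?_⟩) (Or.inl h4))
  · simp [normalSy1]
  · simp [normalSy2]
  · simp [normalPy]
    have := mul_pos hcot p2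
    linarith

theorem GammaCone_subset_closure_Om {v σ₁ σ₂ : ℝ} (hv : 1 < v)
    (hσ₁ : σ₁ ∈ Ioo 0 (criticalAngle v)) (hσ₂ : σ₂ ∈ Ioo 0 (criticalAngle v)) :
    GammaCone v ⊆ closure (Om v σ₁ σ₂) := by
  intro z hz
  obtain ⟨h0, h1, h2, h4⟩ := (mem_GammaCone_iff hv).1 hz
  -- Move towards the axis of the Mach cone; the derivative of its defining function is `x₃ - v <
  -- 0`.
  refine mem_closure_of_eventually (eventually_mem_Om hv (a := ![0, 0, 1]) h0 (Or.inl h1)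
    (Or.inl h2) (Or.inl ?_) (Or.inr ⟨h4, ?_⟩))
  · by_contra! h
    exact (lin_normalCone_lt hv hσ₁ hσ₂ h0 h1.le h2.le h).ne h4
  · have e : lin ![0, 0, 1] z = spherePoint z 2 := by rw [lin, dotProduct_three]; simp
    have := spherePoint_sq z
    have h5 : spherePoint z 2 ≤ 1 := by
      nlinarith [sq_nonneg (spherePoint z 0), sq_nonneg (spherePoint z 1),
        sq_nonneg (spherePoint z 2 - 1)]
    rw [h4, e]
    simp [normalCone]
    linarith

theorem lin_normalCone_of_mem_closure {v : ℝ} (hv : 1 < v) {z : ℝ × ℝ}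
    (hz : z ∈ closure (GammaCone v)) : lin (normalCone v) z = -1 :=
  closure_minimal (fun _ hζ => ((mem_GammaCone_iff hv).1 hζ).2.2.2)
    (isClosed_eq (continuous_lin (normalCone v)) continuous_const) hz

theorem mem_closure_GammaCone {v : ℝ} (hv : 1 < v) {z : ℝ × ℝ} (hz : z ∈ chart)
    (h1 : lin normalSy1 z ≤ 0) (h2 : lin normalSy2 z ≤ 0) (h4 : lin (normalCone v) z = -1) :
    z ∈ closure (GammaCone v) := by
  have hv0 : 0 < v := by linarith
  by_cases hlt : lin normalSy1 z < 0 ∧ lin normalSy2 z < 0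
  · exact subset_closure ((mem_GammaCone_iff hv).2 ⟨hz, hlt.1, hlt.2, h4⟩)
  -- Only the end points of the arc remain. The function `f` solves `v * cos t * sin (f t) = 1`, so
  -- `(π / 2 + t, f t)` and `(π - f t, π / 2 - t)` stay on the cone and approach the two end points
  -- from inside the quadrant.
  set f : ℝ → ℝ := fun t => arcsin (1 / (v * cos t)) with hf
  have hcv : Tendsto (fun t => 1 / (v * cos t)) (𝓝[>] 0) (𝓝 (1 / v)) := by
    have : ContinuousAt (fun t => 1 / (v * cos t)) 0 := by
      refine ContinuousAt.div (by fun_prop) (by fun_prop) (by simp [hv0.ne'])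
    have := this.tendsto.mono_left (nhdsWithin_le_nhds (s := Ioi 0))
    simpa using this
  have hfc : Tendsto f (𝓝[>] 0) (𝓝 (arcsin (1 / v))) :=
    (continuous_arcsin.tendsto _).comp hcv
  have hev : ∀ᶠ t in 𝓝[>] (0 : ℝ), 1 / (v * cos t) < 1 :=
    hcv.eventually_lt_const ((div_lt_one hv0).2 hv)
  have hsmall : ∀ᶠ t in 𝓝[>] (0 : ℝ), t ∈ Ioo 0 (π / 2) :=
    Ioo_mem_nhdsGT (by positivity)
  have hid : Tendsto (fun t : ℝ => t) (𝓝[>] 0) (𝓝 0) := tendsto_id.mono_left nhdsWithin_le_nhds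
  have hprop : ∀ᶠ t in 𝓝[>] (0 : ℝ), 0 < sin t ∧ 0 < cos t ∧ t < π / 2 ∧ 0 < t ∧
      f t ∈ Ioo 0 (π / 2) ∧ 0 < cos (f t) ∧ cos t * sin (f t) = 1 / v := by
    filter_upwards [hev, hsmall] with t ht1 ht2
    have c : 0 < cos t := cos_pos_of_mem_Ioo ⟨by linarith [ht2.1, pi_pos], ht2.2⟩
    have hpos : 0 < 1 / (v * cos t) := by positivity
    have hm : f t ∈ Ioo 0 (π / 2) := ⟨arcsin_pos.2 hpos, arcsin_lt_pi_div_two.2 ht1⟩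
    refine ⟨sin_pos_of_pos_of_lt_pi ht2.1 (by linarith [ht2.2, pi_pos]), c, ht2.2, ht2.1, hm,
      cos_pos_of_mem_Ioo ⟨by linarith [hm.1, pi_pos], hm.2⟩, ?_⟩
    rw [hf, sin_arcsin (by linarith) ht1.le]
    field_simp
  rw [lin_normalSy1] at h1 hlt
  rw [lin_normalSy2] at h2 hlt
  rw [lin_normalCone] at h4
  simp only [spherePoint, Matrix.cons_val_zero, Matrix.cons_val_one, Matrix.cons_val] at h1 h2 h4 hlt
  have s1 := sin_pos_of_mem_Ioo hz.1
  have s2 := sin_pos_of_mem_Ioo hz.2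
  have hcos : ∀ x ∈ Ioo 0 π, cos x = 0 → x = π / 2 := fun x hx h =>
    injOn_cos (Ioo_subset_Icc_self hx) ⟨by positivity, by linarith [pi_pos]⟩ (by simp [h])
  by_cases h0 : cos z.1 = 0
  · have hz1 := hcos _ hz.1 h0
    have hz2 : z.2 = arcsin (1 / v) := by
      have e : 1 / v = sin z.2 := by
        rw [hz1, sin_pi_div_two] at h4
        rw [div_eq_iff hv0.ne']; linarith
      have hc : 0 ≤ cos z.2 := by
        rw [hz1, sin_pi_div_two] at h2; linarith
      rw [e, arcsin_sin (by linarith [hz.2.1, pi_pos])]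
      by_contra! h
      exact absurd (cos_neg_of_pi_div_two_lt_of_lt h (by linarith [hz.2.2, pi_pos])) (by linarith)
    refine mem_closure_of_tendsto (b := 𝓝[>] (0 : ℝ)) (f := fun t : ℝ => (π / 2 + t, f t)) ?_ ?_
    · have : z = (π / 2 + 0, arcsin (1 / v)) := by
        ext <;> simp [hz1, hz2]
      rw [this]
      exact (tendsto_const_nhds.add hid).prodMk_nhds hfc
    · filter_upwards [hprop] with t ⟨t1, t2, t3, t4, t5, t6, t7⟩
      rw [mem_GammaCone_iff hv, lin_normalSy1, lin_normalSy2, lin_normalCone]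
      have e1 : sin (π / 2 + t) = cos t := by rw [add_comm, sin_add_pi_div_two]
      have e2 : cos (π / 2 + t) = -sin t := by rw [add_comm, cos_add_pi_div_two]
      simp only [spherePoint, Matrix.cons_val_zero, Matrix.cons_val_one, Matrix.cons_val, e1, e2, t7]
      refine ⟨⟨⟨by simp only; linarith [pi_pos], by simp only; linarith⟩, t5.1, by
        simp only; linarith [t5.2, pi_pos]⟩, by linarith, ?_, ?_⟩
      · have := mul_pos t2 t6; linarith
      · field_simp
  · have h1' : cos z.1 < 0 := lt_of_le_of_ne h1 h0
    have h0' : cos z.2 = 0 := by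
      by_contra h
      refine hlt ⟨h1', lt_of_le_of_ne h2 ?_⟩
      simp [h, s1.ne']
    have hz2 := hcos _ hz.2 h0'
    have hz1 : z.1 = π - arcsin (1 / v) := by
      have e : 1 / v = sin (π - z.1) := by
        rw [hz2, sin_pi_div_two] at h4
        rw [sin_pi_sub, div_eq_iff hv0.ne']; linarith
      rw [e, arcsin_sin (by linarith [hz.1.2, pi_pos])]
      · ring
      · by_contra! h
        exact absurd (cos_pos_of_mem_Ioo ⟨by linarith [hz.1.1, pi_pos], by linarith⟩) h1'.not_gt
    refine mem_closure_of_tendsto (b := 𝓝[>] (0 : ℝ)) (f := fun t : ℝ => (π - f t, π / 2 - t)) ?_ ?_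
    · have : z = (π - arcsin (1 / v), π / 2 - 0) := by
        ext <;> simp [hz1, hz2]
      rw [this]
      exact (tendsto_const_nhds.sub hfc).prodMk_nhds (tendsto_const_nhds.sub hid)
    · filter_upwards [hprop] with t ⟨t1, t2, t3, t4, t5, t6, t7⟩
      rw [mem_GammaCone_iff hv, lin_normalSy1, lin_normalSy2, lin_normalCone]
      simp only [spherePoint, Matrix.cons_val_zero, Matrix.cons_val_one, Matrix.cons_val, sin_pi_sub,
        cos_pi_sub, sin_pi_div_two_sub, cos_pi_div_two_sub]
      have t5' : 0 < sin (f t) := sin_pos_of_pos_of_lt_pi t5.1 (by linarith [t5.2, pi_pos])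
      refine ⟨⟨⟨by simp only; linarith [t5.2, pi_pos], by simp only; linarith [t5.1]⟩, by
        simp only; linarith, by simp only; linarith [pi_pos]⟩, by linarith, ?_, ?_⟩
      · have := mul_pos t5' t1; linarith
      · rw [mul_comm (sin (f t)), t7]; field_simp

theorem mem_OmBar_iff {v σ₁ σ₂ : ℝ} (hv : 1 < v) (hσ₁ : σ₁ ∈ Ioo 0 (criticalAngle v))
    (hσ₂ : σ₂ ∈ Ioo 0 (criticalAngle v)) {z : ℝ × ℝ} : z ∈ OmBar v σ₁ σ₂ ↔
    z ∈ chart ∧ lin normalSy1 z ≤ 0 ∧ lin normalSy2 z ≤ 0 ∧ lin (normalPy σ₁ σ₂) z ≤ 0 ∧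
      lin (normalCone v) z < -1 := by
  constructor
  · intro h
    obtain ⟨h0, h1, h2, h3, h4⟩ := closure_Om_subset hv h.1
    exact ⟨h0, h1, h2, h3, lt_of_le_of_ne h4 fun h5 => h.2 (mem_closure_GammaCone hv h0 h1 h2 h5)⟩
  · rintro ⟨h0, h1, h2, h3, h4⟩
    exact ⟨mem_closure_Om hv hσ₁ hσ₂ h0 h1 h2 h3 h4,
      fun h => h4.ne (lin_normalCone_of_mem_closure hv h)⟩

/-! ### One-sided derivatives and the wall conditions. -/

section

variable {v σ₁ σ₂ : ℝ}

theorem Om_subset_OmBar (hv : 1 < v) : Om v σ₁ σ₂ ⊆ OmBar v σ₁ σ₂ := fun _ hz =>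
  ⟨subset_closure hz, fun h =>
    ((mem_Om_iff hv).1 hz).2.2.2.2.ne (lin_normalCone_of_mem_closure hv h)⟩

theorem Om_subset_OmBar_diff_Corners (hv : 1 < v) :
    Om v σ₁ σ₂ ⊆ OmBar v σ₁ σ₂ \ Corners σ₁ σ₂ := by
  refine fun z hz => ⟨Om_subset_OmBar hv hz, fun h => ?_⟩
  rcases h.2.2 with h' | h'
  · exact hz.2.2.2.1.ne' (congrArg Prod.snd h')
  · exact hz.2.2.1.ne (congrArg Prod.fst h')

theorem tangentDir_add_smul (a b : Fin 3 → ℝ) (s : ℝ) (z : ℝ × ℝ) :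
    tangentDir (a + s • b) z = tangentDir a z + s • tangentDir b z := by
  ext <;> simp [tangentDir, add_dotProduct, smul_dotProduct]
  ring

theorem exists_tangentDir_eq {z : ℝ × ℝ} (hs : sin z.1 ≠ 0) (d : ℝ × ℝ) :
    ∃ a, tangentDir a z = d := by
  refine ⟨d.1 • eTheta z + (sin z.1 * d.2) • ePhi z, ?_⟩
  have h1 := sin_sq_add_cos_sq z.1
  have h2 := sin_sq_add_cos_sq z.2
  have e1 : eTheta z ⬝ᵥ eTheta z = 1 := by
    rw [dotProduct_eTheta]; simp [eTheta]
    linear_combination cos z.1 ^ 2 * h2 + h1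
  have e2 : ePhi z ⬝ᵥ eTheta z = 0 := by
    rw [dotProduct_eTheta]; simp [ePhi]; ring
  have e3 : eTheta z ⬝ᵥ ePhi z = 0 := by rw [dotProduct_comm, e2]
  have e4 : ePhi z ⬝ᵥ ePhi z = 1 := by
    rw [dotProduct_ePhi]; simp [ePhi]
    linear_combination h2
  ext <;> simp only [tangentDir, add_dotProduct, smul_dotProduct, e1, e2, e3, e4, smul_eq_mul]
  · ring
  · field_simp
    ring

theorem mem_tangentConeAt_of_eventually {s : Set (ℝ × ℝ)} {z d : ℝ × ℝ}
    (h : ∀ᶠ t : ℝ in 𝓝[>] 0, z + t • d ∈ s) : d ∈ tangentConeAt ℝ s z :=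
  mem_tangentConeAt_of_add_smul_mem (l := 𝓝[>] (0 : ℝ)) (c := id)
    (tendsto_id.mono_left (nhdsWithin_mono _ fun _ hx => (ne_of_gt hx : _))) h

/-- Needed for the continuity of `fderivWithin` up to the boundary. Vectors pointing strictly inside
all walls form an open set; differences `(a₀ + s • b) - a₀` of such vectors span, and their
projections lie in the tangent cone. -/
theorem uniqueDiffOn_OmBar (hv : 1 < v) (hσ₁ : σ₁ ∈ Ioo 0 (criticalAngle v))
    (hσ₂ : σ₂ ∈ Ioo 0 (criticalAngle v)) : UniqueDiffOn ℝ (OmBar v σ₁ σ₂) := by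
  intro z hz
  obtain ⟨h0, h1, h2, h3, h4⟩ := (mem_OmBar_iff hv hσ₁ hσ₂).1 hz
  obtain ⟨p1, q1, r1⟩ := angle_bounds hv hσ₁
  obtain ⟨p2, q2, r2⟩ := angle_bounds hv hσ₂
  have hcot : 0 < cot σ₁ := pos_of_mul_pos_left (by rw [r1]; norm_num) p1.le
  refine ⟨?_, subset_closure hz⟩
  have hcone : ∀ a : Fin 3 → ℝ, normalSy1 ⬝ᵥ a < 0 → normalSy2 ⬝ᵥ a < 0 →
      normalPy σ₁ σ₂ ⬝ᵥ a < 0 → tangentDir a z ∈ tangentConeAt ℝ (OmBar v σ₁ σ₂) z := by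
    intro a a1 a2 a3
    refine mem_tangentConeAt_of_eventually ((eventually_mem_Om (σ₁ := σ₁) (σ₂ := σ₂) hv h0
      (h1.lt_or_eq.imp_right fun h => ⟨h, a1⟩) (h2.lt_or_eq.imp_right fun h => ⟨h, a2⟩)
      (h3.lt_or_eq.imp_right fun h => ⟨h, a3⟩) (Or.inl h4)).mono fun _ ht => Om_subset_OmBar hv ht)
  set a₀ : Fin 3 → ℝ := ![-1, 1, 0] with ha₀
  have b1 : normalSy1 ⬝ᵥ a₀ < 0 := by simp [normalSy1, ha₀]
  have b2 : normalSy2 ⬝ᵥ a₀ < 0 := by simp [normalSy2, ha₀]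
  have b3 : normalPy σ₁ σ₂ ⬝ᵥ a₀ < 0 := by
    simp [normalPy, ha₀]
    have := mul_pos hcot p2
    linarith
  have htop : Submodule.span ℝ (tangentConeAt ℝ (OmBar v σ₁ σ₂) z) = ⊤ := by
    refine Submodule.eq_top_iff'.2 fun d => ?_
    obtain ⟨b, rfl⟩ := exists_tangentDir_eq (sin_pos_of_mem_Ioo h0.1).ne' d
    have hev : ∀ n : Fin 3 → ℝ, n ⬝ᵥ a₀ < 0 → ∀ᶠ s : ℝ in 𝓝[>] 0, n ⬝ᵥ (a₀ + s • b) < 0 := by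
      intro n hn
      have : Continuous fun s : ℝ => n ⬝ᵥ a₀ + s * (n ⬝ᵥ b) := by fun_prop
      have h := (this.tendsto 0).mono_left (nhdsWithin_le_nhds (s := Ioi 0))
      filter_upwards [h.eventually_lt_const (u := 0) (by simpa using hn)] with s hs
      simpa [dotProduct_add, dotProduct_smul] using hs
    obtain ⟨s, s1, s2, s3, s0⟩ := ((hev _ b1).and ((hev _ b2).and
      ((hev _ b3).and self_mem_nhdsWithin))).exists
    have m1 := Submodule.subset_span (R := ℝ) (hcone _ s1 s2 s3)
    have m0 := Submodule.subset_span (R := ℝ) (hcone _ b1 b2 b3)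
    have := Submodule.smul_mem _ s⁻¹ (Submodule.sub_mem _ m1 m0)
    rwa [tangentDir_add_smul, add_sub_cancel_left, inv_smul_smul₀ (ne_of_gt s0)] at this
  rw [htop]
  exact dense_univ

theorem normalDeriv_eq (s : Set (ℝ × ℝ)) (n : Fin 3 → ℝ) (ψ : ℝ × ℝ → ℝ) (ζ : ℝ × ℝ) :
    normalDeriv s n ψ ζ = fderivWithin ℝ ψ s ζ (tangentDir n ζ) := by
  have : tangentDir n ζ = (n ⬝ᵥ eTheta ζ) • ((1, 0) : ℝ × ℝ) + (n ⬝ᵥ ePhi ζ / sin ζ.1) • (0, 1) := by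
    simp [tangentDir]
  rw [this, map_add, map_smul, map_smul, normalDeriv, smul_eq_mul, smul_eq_mul]
  ring

/-- The wing condition extends to the end points of the wing. -/
theorem normalDeriv_py_eq_zero (hv : 1 < v) (hσ₁ : σ₁ ∈ Ioo 0 (criticalAngle v))
    (hσ₂ : σ₂ ∈ Ioo 0 (criticalAngle v)) {ψ : ℝ × ℝ → ℝ} (hψ : ContDiffOn ℝ 1 ψ (OmBar v σ₁ σ₂))
    (hpy : ∀ ζ ∈ GammaPy σ₁ σ₂, normalDeriv (OmBar v σ₁ σ₂) (normalPy σ₁ σ₂) ψ ζ = 0)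
    {z : ℝ × ℝ} (hz : z ∈ OmBar v σ₁ σ₂) (hzp : lin (normalPy σ₁ σ₂) z = 0) :
    normalDeriv (OmBar v σ₁ σ₂) (normalPy σ₁ σ₂) ψ z = 0 := by
  obtain ⟨h0, h1, h2, h3, h4⟩ := (mem_OmBar_iff hv hσ₁ hσ₂).1 hz
  obtain ⟨p1, q1, r1⟩ := angle_bounds hv hσ₁
  obtain ⟨p2, q2, r2⟩ := angle_bounds hv hσ₂
  have hcot : 0 < cot σ₁ := pos_of_mul_pos_left (by rw [r1]; norm_num) p1.le
  have hcont : ContinuousOn (fun ζ => normalDeriv (OmBar v σ₁ σ₂) (normalPy σ₁ σ₂) ψ ζ)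
      (OmBar v σ₁ σ₂) := by
    simp only [normalDeriv_eq]
    refine (hψ.continuousOn_fderivWithin (uniqueDiffOn_OmBar hv hσ₁ hσ₂) le_rfl).clm_apply ?_
    intro w hw
    have hs : sin w.1 ≠ 0 := (sin_pos_of_mem_Ioo ((mem_OmBar_iff hv hσ₁ hσ₂).1 hw).1.1).ne'
    refine ContinuousAt.continuousWithinAt ?_
    have e : tangentDir (normalPy σ₁ σ₂) = fun ζ => _ := funext fun ζ => by
      rw [tangentDir, dotProduct_eTheta, dotProduct_ePhi]
    rw [e]
    exact ContinuousAt.prodMk (by fun_prop) (ContinuousAt.div (by fun_prop) (by fun_prop) hs)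
  -- On the plane of the wing `cot θ = g φ`, so `c` parametrises the wing by `φ`.
  set g : ℝ → ℝ := fun s => cot σ₁ * tan σ₂ * cos s - tan σ₂ * sin s with hg
  set c : ℝ → ℝ × ℝ := fun s => (π / 2 - arctan (g s), s) with hc
  have hgc : Continuous g := by fun_prop
  have hcc : Continuous c := (continuous_const.sub (continuous_arctan.comp hgc)).prodMk continuous_id
  have hlin : ∀ s, lin (normalPy σ₁ σ₂) (c s) = 0 := by
    intro s
    have : sin (arctan (g s)) = g s * cos (arctan (g s)) := by
      conv_rhs => enter [1]; rw [← tan_arctan (g s)]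
      exact (tan_mul_cos (cos_arctan_pos _).ne').symm
    rw [lin_eq]
    simp only [normalPy, hc, sin_pi_div_two_sub, cos_pi_div_two_sub, this, Matrix.cons_val_zero,
      Matrix.cons_val_one, Matrix.cons_val]
    have hgs : g s = cot σ₁ * tan σ₂ * cos s - tan σ₂ * sin s := rfl
    rw [hgs]
    ring
  have hs1 := sin_pos_of_mem_Ioo h0.1
  have hs2 := sin_pos_of_mem_Ioo h0.2
  have hgz : cos z.1 = sin z.1 * g z.2 := by
    rw [lin_eq] at hzp
    simp [normalPy] at hzp
    simp only [hg]
    linarith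
  have hcz : c z.2 = z := by
    have e : g z.2 = tan (π / 2 - z.1) := by
      rw [tan_eq_sin_div_cos, sin_pi_div_two_sub, cos_pi_div_two_sub, hgz]
      field_simp
    ext
    · simp only [hc]
      rw [e, arctan_tan (by linarith [h0.1.2]) (by linarith [h0.1.1])]
      ring
    · rfl
  rw [lin_normalSy1] at h1
  rw [lin_normalSy2] at h2
  simp only [spherePoint, Matrix.cons_val_zero, Matrix.cons_val_one] at h1 h2
  have hcos : 0 ≤ cos z.2 := by
    by_contra! h
    nlinarith [mul_pos hs1 (neg_pos.2 h)]
  have hg0 : g z.2 ≤ 0 := by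
    by_contra! h
    nlinarith [mul_pos hs1 h]
  have hkey : ∀ l : Filter ℝ, l.NeBot → l ≤ 𝓝 z.2 → (∀ᶠ s in l, 0 < cos s ∧ g s < 0) →
      normalDeriv (OmBar v σ₁ σ₂) (normalPy σ₁ σ₂) ψ z = 0 := by
    intro l hl hle hev
    have hmem : ∀ᶠ s in l, c s ∈ GammaPy σ₁ σ₂ ∧ c s ∈ OmBar v σ₁ σ₂ := by
      filter_upwards [hev, hle (isOpen_Ioo.mem_nhds h0.2)] with s ⟨hs, hs'⟩ hsI
      have hch : c s ∈ chart := by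
        refine ⟨⟨?_, ?_⟩, hsI⟩
        · simp only [hc]; linarith [arctan_lt_pi_div_two (g s)]
        · simp only [hc]; linarith [neg_pi_div_two_lt_arctan (g s)]
      have hA : sin (arctan (g s)) < 0 := sin_neg_of_neg_of_neg_pi_lt (arctan_lt_zero.2 hs')
          (by linarith [neg_pi_div_two_lt_arctan (g s), pi_pos])
      have n1 : lin normalSy1 (c s) < 0 := by
        rw [lin_normalSy1]; simpa [spherePoint, hc, sin_pi_div_two_sub, cos_pi_div_two_sub] using hA
      have n2 : lin normalSy2 (c s) < 0 := by
        rw [lin_normalSy2]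
        have := mul_pos (cos_arctan_pos (g s)) hs
        simpa [spherePoint, hc, sin_pi_div_two_sub, cos_pi_div_two_sub] using this
      exact ⟨mem_GammaPy_of_lin hch n1 n2 (hlin s), (mem_OmBar_iff hv hσ₁ hσ₂).2
        ⟨hch, n1.le, n2.le, (hlin s).le, lin_normalCone_lt hv hσ₁ hσ₂ hch n1.le n2.le (hlin s).ge⟩⟩
    have ht : Tendsto c l (𝓝[OmBar v σ₁ σ₂] z) := by
      refine tendsto_nhdsWithin_iff.2 ⟨?_, hmem.mono fun _ h => h.2⟩
      have := (hcc.tendsto z.2).mono_left hle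
      rwa [hcz] at this
    have hlim := (hcont z hz).tendsto.comp ht
    refine tendsto_nhds_unique (hlim.congr' ?_) tendsto_const_nhds
    filter_upwards [hmem] with s hs using hpy _ hs.1
  -- The wing runs from `P₄`, where `g = 0`, to `P₃`, where `φ = π / 2`. Approaching with increasing
  -- `φ` works everywhere except at `P₃`, which is approached from below.
  rcases lt_or_ge z.2 (π / 2) with hlt | hge
  · refine hkey (𝓝[>] z.2) inferInstance nhdsWithin_le_nhds ?_
    filter_upwards [Ioo_mem_nhdsGT hlt] with s hs
    refine ⟨cos_pos_of_mem_Ioo ⟨by linarith [hs.1, h0.2.1, pi_pos], hs.2⟩, ?_⟩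
    have e1 : cos s < cos z.2 := cos_lt_cos_of_nonneg_of_le_pi h0.2.1.le
      (by linarith [hs.2, pi_pos]) hs.1
    have e2 : sin z.2 < sin s := sin_lt_sin_of_lt_of_le_pi_div_two (by linarith [h0.2.1, pi_pos])
      hs.2.le hs.1
    have := mul_lt_mul_of_pos_left e1 (mul_pos hcot p2)
    have := mul_lt_mul_of_pos_left e2 p2
    simp only [hg] at hg0 ⊢
    linarith
  · have hz2 : z.2 = π / 2 := by
      refine le_antisymm ?_ hge
      by_contra! h
      exact absurd (cos_neg_of_pi_div_two_lt_of_lt h (by linarith [h0.2.2, pi_pos])) (by linarith)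
    have hgneg : g z.2 < 0 := by simp [hg, hz2, p2]
    refine hkey (𝓝[<] z.2) inferInstance nhdsWithin_le_nhds ?_
    filter_upwards [nhdsWithin_le_nhds (hgc.continuousAt.eventually_lt continuousAt_const hgneg),
      Ioo_mem_nhdsLT h0.2.1] with s hs hs'
    exact ⟨cos_pos_of_mem_Ioo ⟨by linarith [hs'.1, pi_pos], by linarith [hs'.2]⟩, hs⟩

/-- Comparison with linear functions at a wall. -/
theorem nonneg_of_isMinOn_wall {s : Set (ℝ × ℝ)} {τ : ℝ} {ψ : ℝ × ℝ → ℝ} {a n : Fin 3 → ℝ}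
    {z : ℝ × ℝ} (hz : z ∈ chart) (hψ : DifferentiableWithinAt ℝ ψ s z)
    (hn : lin n z = 0) (hd : normalDeriv s n ψ z = 0)
    (hev : ∀ᶠ t : ℝ in 𝓝[>] 0, z + t • tangentDir (-n) z ∈ s)
    (hmin : IsMinOn (fun w => τ * (ψ w - lin a w)) s z) : 0 ≤ τ * (n ⬝ᵥ a) := by
  have hs : sin z.1 ≠ 0 := (sin_pos_of_mem_Ioo hz.1).ne'
  have hfd := (hψ.hasFDerivWithinAt.sub (hasFDerivAt_lin a z).hasFDerivWithinAt).const_mul τ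
  have key := hmin.localize.hasFDerivWithinAt_nonneg hfd
    (mem_posTangentConeAt_of_frequently_mem hev.frequently)
  have e : tangentDir (-n) z = -tangentDir n z := by
    ext <;> simp [tangentDir, neg_div]
  rw [normalDeriv_eq] at hd
  have hl := tangentDir_lin n a hs
  rw [hn, mul_zero, sub_zero] at hl
  rw [e] at key
  rw [dotProduct_comm, ← hl]
  refine key.trans_eq ?_
  rw [map_neg]
  simp only [smul_apply, sub_apply, add_apply, hd, smul_eq_mul]
  simp [tangentDir]
  ring

/-! ### Minima lie on the Mach cone. -/

/-- If `ψ` lies above `1` and the linear function `lin a` is a strict sub- (`τ > 0`) or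
supersolution (`τ < 0`) at the walls, then the minimum of `τ * (ψ - lin a)` is on the Mach cone,
unless `τ * (ψ - lin a)` is nonpositive there. -/
theorem IsSolution.mem_closure_GammaCone_of_isMinOn {μ ε τ : ℝ} {ψ : ℝ × ℝ → ℝ} (hv : 1 < v)
    (hσ₁ : σ₁ ∈ Ioo 0 (criticalAngle v)) (hσ₂ : σ₂ ∈ Ioo 0 (criticalAngle v))
    (hμ : μ ∈ Icc (0 : ℝ) 1) (hψ : IsSolution v σ₁ σ₂ μ ε ψ)
    (h1 : ∀ ζ ∈ OmBar v σ₁ σ₂, 1 < ψ ζ) {a : Fin 3 → ℝ} {z : ℝ × ℝ}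
    (hz : z ∈ closure (Om v σ₁ σ₂))
    (hmin : IsMinOn (fun w => τ * (ψ w - lin a w)) (closure (Om v σ₁ σ₂)) z)
    (ha1 : τ * (normalSy1 ⬝ᵥ a) < 0) (ha2 : τ * (normalSy2 ⬝ᵥ a) < 0)
    (ha3 : τ * (normalPy σ₁ σ₂ ⬝ᵥ a) < 0)
    (hpos : z ∈ Om v σ₁ σ₂ → 0 < τ * (ψ z - lin a z)) : z ∈ closure (GammaCone v) := by
  by_contra hnot
  have hzb : z ∈ OmBar v σ₁ σ₂ := ⟨hz, hnot⟩
  obtain ⟨h0, k1, k2, k3, k4⟩ := (mem_OmBar_iff hv hσ₁ hσ₂).1 hzb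
  obtain ⟨p1, q1, r1⟩ := angle_bounds hv hσ₁
  obtain ⟨p2, q2, r2⟩ := angle_bounds hv hσ₂
  have hcot : 0 < cot σ₁ := pos_of_mul_pos_left (by rw [r1]; norm_num) p1.le
  have hct := mul_pos hcot p2
  have hτ : τ ≠ 0 := fun h => by simp [h] at ha1
  have hdiff : DifferentiableWithinAt ℝ ψ (OmBar v σ₁ σ₂) z :=
    (hψ.contDiffOn_one z hzb).differentiableWithinAt (by norm_num)
  have hminb : IsMinOn (fun w => τ * (ψ w - lin a w)) (OmBar v σ₁ σ₂) z :=
    hmin.on_subset sdiff_subset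
  -- The wing is treated before the symmetry walls so that it takes in both corners: first
  -- derivatives suffice there, and `-normalPy` points strictly inside both symmetry planes.
  rcases k3.lt_or_eq with k3 | k3
  swap
  · refine ha3.not_ge (nonneg_of_isMinOn_wall h0 hdiff k3
      (normalDeriv_py_eq_zero hv hσ₁ hσ₂ hψ.contDiffOn_one hψ.py hzb k3) ?_ hminb)
    refine (eventually_mem_Om hv h0 (k1.lt_or_eq.imp_right fun h => ⟨h, ?_⟩)
      (k2.lt_or_eq.imp_right fun h => ⟨h, ?_⟩) (Or.inr ⟨k3, ?_⟩) (Or.inl k4)).mono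
      fun _ ht => Om_subset_OmBar hv ht
    · simp [normalSy1, normalPy]
    · simp [normalSy2, normalPy]; linarith
    · simp [normalPy]; nlinarith [sq_nonneg (tan σ₂)]
  have hx := spherePoint_two_pos h0
  have hsq := spherePoint_sq z
  have hv0 : 0 < v := by linarith
  have hroot : 0 < √(v ^ 2 - 1) := sqrt_pos.2 (by nlinarith)
  have hcone : (spherePoint z 0) ^ 2 + (spherePoint z 1) ^ 2
      < (√(v ^ 2 - 1) * spherePoint z 2) ^ 2 := by
    rw [mul_pow, sq_sqrt (by nlinarith)]
    rw [lin_normalCone] at k4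
    have : 1 < (v * spherePoint z 2) ^ 2 := (one_lt_sq_iff₀ (by positivity)).2 (by linarith)
    nlinarith
  have m1 := lin_normalSy1 z
  have m2 := lin_normalSy2 z
  have m3 := lin_normalPy σ₁ σ₂ z
  rcases k1.lt_or_eq with k1 | k1
  swap
  · have hy : spherePoint z 2 < spherePoint z 1 * cot σ₁ := by
      by_contra! h
      nlinarith
    have hy' : spherePoint z 2 * tan σ₁ < spherePoint z 1 := by
      have := mul_lt_mul_of_pos_right hy p1
      rwa [mul_assoc, r1, mul_one] at this
    have hzs : z ∈ GammaSy1 v σ₁ := by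
      refine ⟨h0.1, h0.2, ?_, ?_, ?_⟩
      · simp only [toConical]; rw [← m1, k1, zero_div]
      · simp only [toConical]; rw [lt_div_iff₀ hx]; linarith
      · simp only [toConical]; rw [div_lt_iff₀ hx]
        exact lt_of_pow_lt_pow_left₀ 2 (by positivity) (by nlinarith [sq_nonneg (spherePoint z 0)])
    refine ha1.not_ge (nonneg_of_isMinOn_wall h0 hdiff k1 (hψ.sy1 z hzs) ?_ hminb)
    refine (eventually_mem_Om hv h0 (Or.inr ⟨k1, ?_⟩) (Or.inl ?_) (Or.inl k3) (Or.inl k4)).mono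
      fun _ ht => Om_subset_OmBar hv ht
    · simp [normalSy1]
    · rw [m2]; nlinarith [mul_pos hx p1]
  rcases k2.lt_or_eq with k2 | k2
  swap
  · have hx1 : spherePoint z 1 = 0 := by linarith
    have hy : spherePoint z 0 < -tan σ₂ * spherePoint z 2 := by
      rw [m3, hx1] at k3; linarith
    have hzs : z ∈ GammaSy2 v σ₂ := by
      refine ⟨h0.1, h0.2, ?_, ?_, ?_⟩
      · simp only [toConical]; rw [hx1, zero_div]
      · simp only [toConical]; rw [lt_div_iff₀ hx]
        have : -spherePoint z 0 < √(v ^ 2 - 1) * spherePoint z 2 :=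
          lt_of_pow_lt_pow_left₀ 2 (by positivity) (by nlinarith [sq_nonneg (spherePoint z 1)])
        linarith
      · simp only [toConical]; rw [div_lt_iff₀ hx]; exact hy
    refine ha2.not_ge (nonneg_of_isMinOn_wall h0 hdiff k2 (hψ.sy2 z hzs) ?_ hminb)
    refine (eventually_mem_Om hv h0 (Or.inl k1) (Or.inr ⟨k2, ?_⟩) (Or.inl k3) (Or.inl k4)).mono
      fun _ ht => Om_subset_OmBar hv ht
    simp [normalSy2]
  have hzO : z ∈ Om v σ₁ σ₂ := (mem_Om_iff hv).2 ⟨h0, k1, k2, k3, k4⟩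
  have hnhds : Om v σ₁ σ₂ ∈ 𝓝 z := (isOpen_Om hv).mem_nhds hzO
  refine opN_ne_zero_of_isLocalMin hμ (sin_pos_of_mem_Ioo h0.1)
    ((hψ.contDiffOn_two.mono (Om_subset_OmBar_diff_Corners hv)).contDiffAt hnhds)
    ((hmin.on_subset subset_closure).isLocalMin hnhds) hτ (h1 z hzb) (hpos hzO) (hψ.equation z hzO)

theorem IsSolution.eq_of_mem_closure_GammaCone {μ ε : ℝ} {ψ : ℝ × ℝ → ℝ} (hv : 1 < v)
    (hσ₁ : σ₁ ∈ Ioo 0 (criticalAngle v)) (hσ₂ : σ₂ ∈ Ioo 0 (criticalAngle v))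
    (hψ : IsSolution v σ₁ σ₂ μ ε ψ) {z : ℝ × ℝ} (hz : z ∈ closure (GammaCone v)) :
    ψ z = 1 + ε := by
  have hsub : closure (GammaCone v) ⊆ closure (Om v σ₁ σ₂) :=
    closure_minimal (GammaCone_subset_closure_Om hv hσ₁ hσ₂) isClosed_closure
  exact Set.EqOn.of_subset_closure (f := ψ) (g := fun _ => 1 + ε) hψ.cone
    (hψ.continuousOn.mono hsub) continuousOn_const subset_closure subset_rfl hz

/-! ### The lower bound. -/

theorem one_sub_lin_spherePoint (ζ z : ℝ × ℝ) : 1 - lin (spherePoint ζ) z =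
    ((spherePoint ζ 0 - spherePoint z 0) ^ 2 + (spherePoint ζ 1 - spherePoint z 1) ^ 2
      + (spherePoint ζ 2 - spherePoint z 2) ^ 2) / 2 := by
  rw [lin, dotProduct_three]
  linear_combination (spherePoint_sq ζ + spherePoint_sq z) * (-1 / 2)

theorem lin_spherePoint_le_one (ζ z : ℝ × ℝ) : lin (spherePoint ζ) z ≤ 1 := by
  have := one_sub_lin_spherePoint ζ z
  have : 0 ≤ 1 - lin (spherePoint ζ) z := by rw [this]; positivity
  linarith

theorem lin_spherePoint_lt_one {ζ z : ℝ × ℝ} (hζ : ζ ∈ chart) (hz : z ∈ chart) (hne : ζ ≠ z) :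
    lin (spherePoint ζ) z < 1 := by
  refine lt_of_le_of_ne (lin_spherePoint_le_one ζ z) fun h => hne ?_
  have := one_sub_lin_spherePoint ζ z
  rw [h] at this
  have e0 : spherePoint ζ 0 = spherePoint z 0 := by
    nlinarith [sq_nonneg (spherePoint ζ 0 - spherePoint z 0),
      sq_nonneg (spherePoint ζ 1 - spherePoint z 1), sq_nonneg (spherePoint ζ 2 - spherePoint z 2)]
  have e1 : spherePoint ζ 1 = spherePoint z 1 := by
    nlinarith [sq_nonneg (spherePoint ζ 0 - spherePoint z 0),
      sq_nonneg (spherePoint ζ 1 - spherePoint z 1), sq_nonneg (spherePoint ζ 2 - spherePoint z 2)]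
  simp only [spherePoint, Matrix.cons_val_zero, Matrix.cons_val_one] at e0 e1
  have f0 := injOn_cos (Ioo_subset_Icc_self hζ.1) (Ioo_subset_Icc_self hz.1) e0
  rw [f0] at e1
  have f1 := injOn_cos (Ioo_subset_Icc_self hζ.2) (Ioo_subset_Icc_self hz.2)
    (mul_left_cancel₀ (sin_pos_of_mem_Ioo hz.1).ne' e1)
  exact Prod.ext f0 f1

theorem continuous_lin_spherePoint :
    Continuous fun p : (ℝ × ℝ) × (ℝ × ℝ) => lin (spherePoint p.1) p.2 := by
  simp only [lin_eq, spherePoint, Matrix.cons_val_zero, Matrix.cons_val_one, Matrix.cons_val]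
  fun_prop

/-- The lower bound by the squared chordal distance to the Mach cone. -/
theorem IsSolution.exists_le {μ ε : ℝ} {ψ : ℝ × ℝ → ℝ} (hv : 1 < v)
    (hσ₁ : σ₁ ∈ Ioo 0 (criticalAngle v)) (hσ₂ : σ₂ ∈ Ioo 0 (criticalAngle v))
    (hμ : μ ∈ Icc (0 : ℝ) 1) (hε : 0 < ε) (hψ : IsSolution v σ₁ σ₂ μ ε ψ)
    (h1 : ∀ ζ ∈ OmBar v σ₁ σ₂, 1 + ε ≤ ψ ζ) {ζ : ℝ × ℝ} (hζ : ζ ∈ closure (Om v σ₁ σ₂)) :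
    ∃ z ∈ closure (GammaCone v), 1 + ε + (1 - lin (spherePoint ζ) z) ≤ ψ ζ := by
  have hsub : closure (GammaCone v) ⊆ closure (Om v σ₁ σ₂) :=
    closure_minimal (GammaCone_subset_closure_Om hv hσ₁ hσ₂) isClosed_closure
  have hcpt := isCompact_closure_Om (σ₁ := σ₁) (σ₂ := σ₂) hv
  have hcpt2 : IsCompact (closure (GammaCone v)) := hcpt.of_isClosed_subset isClosed_closure hsub
  set S : Set ((ℝ × ℝ) × (ℝ × ℝ)) := closure (Om v σ₁ σ₂) ×ˢ closure (GammaCone v) with hS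
  have hcont : ContinuousOn (fun p : (ℝ × ℝ) × (ℝ × ℝ) =>
      ψ p.1 - (1 + ε + (1 - lin (spherePoint p.1) p.2))) S :=
    (hψ.continuousOn.comp continuousOn_fst fun p hp => hp.1).sub
      (continuous_const.add (continuous_const.sub continuous_lin_spherePoint)).continuousOn
  -- The point `z` need not depend continuously on `w`. Projecting the compact set of admissible
  -- pairs gives a closed set, so the bound passes from `Om` to its closure.
  set T := S ∩ (fun p : (ℝ × ℝ) × (ℝ × ℝ) =>
      ψ p.1 - (1 + ε + (1 - lin (spherePoint p.1) p.2))) ⁻¹' Ici 0 with hT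
  have hTc : IsCompact T := (hcpt.prod hcpt2).of_isClosed_subset
    (hcont.preimage_isClosed_of_isClosed (isClosed_closure.prod isClosed_closure) isClosed_Ici)
    inter_subset_left
  have hclosed : IsClosed (Prod.fst '' T) := (hTc.image continuous_fst).isClosed
  have hOm : Om v σ₁ σ₂ ⊆ Prod.fst '' T := by
    intro w hw
    obtain ⟨w0, w1, w2, w3, w4⟩ := (mem_Om_iff hv).1 hw
    obtain ⟨z, hz, hmin⟩ := hcpt.exists_isMinOn ⟨w, subset_closure hw⟩
      (f := fun y => 1 * (ψ y - lin (spherePoint w) y))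
      (continuousOn_const.mul (hψ.continuousOn.sub (continuous_lin _).continuousOn))
    have hzc := hψ.mem_closure_GammaCone_of_isMinOn hv hσ₁ hσ₂ hμ
      (fun y hy => by linarith [h1 y hy]) hz hmin
      (by rw [one_mul]; exact w1) (by rw [one_mul]; exact w2) (by rw [one_mul]; exact w3)
      (fun h => by linarith [h1 z (Om_subset_OmBar hv h), lin_spherePoint_le_one w z])
    refine ⟨(w, z), ⟨⟨subset_closure hw, hzc⟩, ?_⟩, rfl⟩
    have h2 : 1 * (ψ z - lin (spherePoint w) z) ≤ 1 * (ψ w - lin (spherePoint w) w) :=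
      hmin (subset_closure hw)
    rw [hψ.eq_of_mem_closure_GammaCone hv hσ₁ hσ₂ hzc] at h2
    have h3 : lin (spherePoint w) w = 1 := by
      have := one_sub_lin_spherePoint w w
      simp at this; linarith
    simp only [mem_preimage, mem_Ici]
    linarith
  obtain ⟨p, hp, rfl⟩ := closure_minimal hOm hclosed hζ
  exact ⟨p.2, hp.1.2, sub_nonneg.1 hp.2⟩

/-! ### The upper bound. -/

theorem IsSolution.le_of_le {μ ε : ℝ} {ψ : ℝ × ℝ → ℝ} (hv : 1 < v)
    (hσ₁ : σ₁ ∈ Ioo 0 (criticalAngle v)) (hσ₂ : σ₂ ∈ Ioo 0 (criticalAngle v))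
    (hμ : μ ∈ Icc (0 : ℝ) 1) (hε : 0 < ε) (hψ : IsSolution v σ₁ σ₂ μ ε ψ)
    (h1 : ∀ ζ ∈ OmBar v σ₁ σ₂, 1 + ε ≤ ψ ζ) {ζ : ℝ × ℝ} (hζ : ζ ∈ closure (Om v σ₁ σ₂)) :
    ψ ζ ≤ 2 * v * (2 + ε) := by
  have hv0 : 0 < v := by linarith
  obtain ⟨p1, q1, r1⟩ := angle_bounds hv hσ₁
  obtain ⟨p2, q2, r2⟩ := angle_bounds hv hσ₂
  have hcot : 0 < cot σ₁ := pos_of_mul_pos_left (by rw [r1]; norm_num) p1.le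
  have hct := mul_pos hcot p2
  -- On the closure `x₃ ≥ 1 / v` and `x₁ - x₂ ≥ -2`, so this `δ` leaves `lin a ≥ 1 / (2 * v)`. A
  -- positive `δ` is what makes the inequalities on the symmetry walls strict.
  set δ := 1 / (4 * v) with hδ
  have hδ0 : 0 < δ := by positivity
  set a : Fin 3 → ℝ := ![δ, -δ, 1] with ha
  have hlin : ∀ y, lin a y = spherePoint y 2 + δ * (spherePoint y 0 - spherePoint y 1) := by
    intro y
    rw [lin, dotProduct_three]; simp [ha]; ring
  have hbd : ∀ y ∈ closure (Om v σ₁ σ₂), 1 / (2 * v) ≤ lin a y ∧ lin a y ≤ 1 := by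
    intro y hy
    obtain ⟨y0, y1, y2, y3, y4⟩ := closure_Om_subset hv hy
    rw [lin_normalSy1] at y1
    rw [lin_normalSy2] at y2
    rw [lin_normalCone] at y4
    have hsq := spherePoint_sq y
    have b0 : -1 ≤ spherePoint y 0 := by
      nlinarith [sq_nonneg (spherePoint y 1), sq_nonneg (spherePoint y 2),
        sq_nonneg (spherePoint y 0 + 1)]
    have b1 : spherePoint y 1 ≤ 1 := by
      nlinarith [sq_nonneg (spherePoint y 0), sq_nonneg (spherePoint y 2),
        sq_nonneg (spherePoint y 1 - 1)]
    have b2 : spherePoint y 2 ≤ 1 := by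
      nlinarith [sq_nonneg (spherePoint y 1), sq_nonneg (spherePoint y 0),
        sq_nonneg (spherePoint y 2 - 1)]
    have b3 : 1 / v ≤ spherePoint y 2 := by rw [div_le_iff₀ hv0]; linarith
    have e : 1 / v = 4 * δ := by rw [hδ]; field_simp
    have e' : 1 / (2 * v) = 2 * δ := by rw [hδ]; field_simp; norm_num
    rw [hlin, e']
    constructor <;> nlinarith
  have hapos : ∀ y ∈ closure (Om v σ₁ σ₂), 0 < lin a y := fun y hy =>
    lt_of_lt_of_le (by positivity) (hbd y hy).1
  have hcpt := isCompact_closure_Om (σ₁ := σ₁) (σ₂ := σ₂) hv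
  -- `K` is the least factor with `ψ + 1 ≤ K * lin a`. The added `1` makes `K * lin a - ψ` equal to
  -- `1` at the contact point, hence a positive minimum.
  obtain ⟨z, hz, hmax⟩ := hcpt.exists_isMaxOn ⟨ζ, hζ⟩ (f := fun y => (ψ y + 1) / lin a y)
    ((hψ.continuousOn.add continuousOn_const).div (continuous_lin _).continuousOn
      fun y hy => (hapos y hy).ne')
  set K := (ψ z + 1) / lin a z with hK
  have hKz : ψ z + 1 = K * lin a z := by rw [hK, div_mul_cancel₀ _ (hapos z hz).ne']
  have hKle : ∀ y ∈ closure (Om v σ₁ σ₂), ψ y + 1 ≤ K * lin a y := fun y hy =>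
    (div_le_iff₀ (hapos y hy)).1 (hmax hy)
  have hge : ∀ y ∈ closure (Om v σ₁ σ₂), 1 + ε ≤ ψ y := fun y hy => by
    by_cases h : y ∈ closure (GammaCone v)
    · exact (hψ.eq_of_mem_closure_GammaCone hv hσ₁ hσ₂ h).ge
    · exact h1 y ⟨hy, h⟩
  have hKpos : 0 < K := div_pos (by linarith [hge z hz]) (hapos z hz)
  have hKlin : ∀ y, lin (K • a) y = K * lin a y := fun y => by simp [lin, smul_dotProduct]
  have hzc : z ∈ closure (GammaCone v) := by
    refine hψ.mem_closure_GammaCone_of_isMinOn (τ := -1) (a := K • a) hv hσ₁ hσ₂ hμ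
      (fun y hy => by linarith [h1 y hy]) hz (fun y hy => ?_) ?_ ?_ ?_ fun _ => ?_
    · simp only [mem_ofPred_eq, hKlin]
      linarith [hKle y hy]
    · rw [dotProduct_smul]
      have : normalSy1 ⬝ᵥ a = δ := by simp [normalSy1, ha]
      rw [this, smul_eq_mul]; nlinarith [mul_pos hKpos hδ0]
    · rw [dotProduct_smul]
      have : normalSy2 ⬝ᵥ a = δ := by simp [normalSy2, ha]
      rw [this, smul_eq_mul]; nlinarith [mul_pos hKpos hδ0]
    · rw [dotProduct_smul]
      have : normalPy σ₁ σ₂ ⬝ᵥ a = δ + cot σ₁ * tan σ₂ * δ + tan σ₂ := by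
        simp [normalPy, ha]; ring
      have h3 : 0 < normalPy σ₁ σ₂ ⬝ᵥ a := by rw [this]; positivity
      rw [smul_eq_mul]; nlinarith [mul_pos hKpos h3]
    · rw [hKlin]; linarith
  have hKb : K ≤ 2 * v * (2 + ε) := by
    rw [hK, hψ.eq_of_mem_closure_GammaCone hv hσ₁ hσ₂ hzc, div_le_iff₀ (hapos z hz)]
    have := mul_le_mul_of_nonneg_left (hbd z hz).1 (by positivity : 0 ≤ 2 * v * (2 + ε))
    have e : 2 * v * (2 + ε) * (1 / (2 * v)) = 1 + ε + 1 := by field_simp; ring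
    linarith
  have := mul_le_mul_of_nonneg_left (hbd ζ hζ).2 hKpos.le
  linarith [hKle ζ hζ]

/-! ### Uniformity away from the Mach cone, and the conclusion. -/

/-- The uniform lower bound away from the Mach cone. -/
theorem exists_uniform_lower_bound (hv : 1 < v) (hσ₁ : σ₁ ∈ Ioo 0 (criticalAngle v))
    (hσ₂ : σ₂ ∈ Ioo 0 (criticalAngle v)) {Ωsub : Set (ℝ × ℝ)} (hsub : Ωsub ⊆ closure (Om v σ₁ σ₂))
    (hdisj : Disjoint (closure Ωsub) (closure (GammaCone v))) :
    ∃ δ₀ : ℝ, 0 < δ₀ ∧ ∀ μ ∈ Icc (0 : ℝ) 1, ∀ ε : ℝ, 0 < ε → ∀ ψ : ℝ × ℝ → ℝ,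
      IsSolution v σ₁ σ₂ μ ε ψ → (∀ ζ ∈ OmBar v σ₁ σ₂, 1 + ε ≤ ψ ζ) →
        ∀ ζ ∈ Ωsub, 1 + ε + δ₀ < ψ ζ := by
  have hsub' : closure Ωsub ⊆ closure (Om v σ₁ σ₂) := closure_minimal hsub isClosed_closure
  have hsubc : closure (GammaCone v) ⊆ closure (Om v σ₁ σ₂) :=
    closure_minimal (GammaCone_subset_closure_Om hv hσ₁ hσ₂) isClosed_closure
  have hcpt := isCompact_closure_Om (σ₁ := σ₁) (σ₂ := σ₂) hv
  have hK := (hcpt.of_isClosed_subset isClosed_closure hsub').prod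
    (hcpt.of_isClosed_subset isClosed_closure hsubc)
  -- The chordal gap depends on neither `μ`, `ε` nor `ψ` and vanishes only when the two points
  -- coincide, so it has a positive lower bound on this compact product.
  obtain ⟨m, hm, hle⟩ := hK.exists_forall_le'
    (f := fun p : (ℝ × ℝ) × (ℝ × ℝ) => 1 - lin (spherePoint p.1) p.2)
    (continuous_const.sub continuous_lin_spherePoint).continuousOn (a := 0) fun p hp =>
      sub_pos.2 (lin_spherePoint_lt_one (closure_Om_subset hv (hsub' hp.1)).1
        (closure_Om_subset hv (hsubc hp.2)).1 fun h =>
          disjoint_left.1 hdisj hp.1 (h ▸ hp.2))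
  refine ⟨m / 2, by positivity, fun μ hμ ε hε ψ hψ h1 ζ hζ => ?_⟩
  obtain ⟨z, hz, hb⟩ := hψ.exists_le hv hσ₁ hσ₂ hμ hε h1 (hsub hζ)
  have := hle (ζ, z) ⟨subset_closure hζ, hz⟩
  simp only at this
  linarith

end

end ChaplyginWing

theorem lemma3p2 (v σ₁ σ₂ : ℝ) (hv : 1 < v)
    (hσ₁ : σ₁ ∈ Set.Ioo 0 (ChaplyginWing.criticalAngle v))
    (hσ₂ : σ₂ ∈ Set.Ioo 0 (ChaplyginWing.criticalAngle v)) :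
    (∀ ε₀ : ℝ, 0 < ε₀ → ∃ C : ℝ, 0 < C ∧
      ∀ μ ∈ Set.Icc (0 : ℝ) 1, ∀ ε ∈ Set.Ioc 0 ε₀, ∀ ψ : ℝ × ℝ → ℝ,
        ChaplyginWing.IsSolution v σ₁ σ₂ μ ε ψ →
        (∀ ζ ∈ ChaplyginWing.OmBar v σ₁ σ₂, 1 + ε ≤ ψ ζ) →
        ∀ ζ ∈ ChaplyginWing.OmBar v σ₁ σ₂, 1 + ε < ψ ζ ∧ ψ ζ ≤ C) ∧
    (∀ Ωsub : Set (ℝ × ℝ), Ωsub ⊆ closure (ChaplyginWing.Om v σ₁ σ₂) →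
      Disjoint (closure Ωsub) (closure (ChaplyginWing.GammaCone v)) →
      ∃ δ₀ : ℝ, 0 < δ₀ ∧
        ∀ μ ∈ Set.Icc (0 : ℝ) 1, ∀ ε : ℝ, 0 < ε → ∀ ψ : ℝ × ℝ → ℝ,
          ChaplyginWing.IsSolution v σ₁ σ₂ μ ε ψ →
          (∀ ζ ∈ ChaplyginWing.OmBar v σ₁ σ₂, 1 + ε ≤ ψ ζ) →
          ∀ ζ ∈ Ωsub, 1 + ε + δ₀ < ψ ζ) := by
  refine ⟨fun ε₀ hε₀ => ⟨2 * v * (2 + ε₀), by positivity, fun μ hμ ε hε ψ hψ h1 ζ hζ => ⟨?_, ?_⟩⟩,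
    fun Ωsub hsub hdisj => ChaplyginWing.exists_uniform_lower_bound hv hσ₁ hσ₂ hsub hdisj⟩
  -- Strictness at a single point is the uniform bound for `Ωsub = {ζ}`.
  · obtain ⟨δ₀, hδ₀, h⟩ := ChaplyginWing.exists_uniform_lower_bound hv hσ₁ hσ₂ (Ωsub := {ζ})
      (Set.singleton_subset_iff.2 hζ.1) (by simpa using hζ.2)
    linarith [h μ hμ ε hε.1 ψ hψ h1 ζ rfl]
  · have := hψ.le_of_le hv hσ₁ hσ₂ hμ hε.1 h1 hζ.1
    nlinarith [hε.2]
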